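/- **Setting.** In each period an agent observes a state $X\in\mathbb R^k$ and shocks $\epsilon=(\epsilon_0,\epsilon_1)\in\mathbb R^2$, and chooses $Y\in\{0,1\}$. The per-period utility of action $d$ is $W_d(X)^\intercal\theta_d+\epsilon_d$, with $W_d:\mathbb R^k\to\mathbb R^{k_d}$ measurable and $\theta_d\in\mathbb R^{k_d}$; $\beta\in(0,1)$ is the discount factor, and the law of next period's $(X',\epsilon')$ is a time-invariant Markov kernel given $(X,\epsilon,Y)$. The agent uses in every period a measurable rule $Y=\sigma(X,\epsilon)$ which, from almost every current state, maximizes the expected discounted sum of utilities $\mathbb E[\sum_{s\ge 0}\beta^{s}u_s]$ among all (possibly time-varying) Markov plans for which this sum converges absolutely, its own sum being absolutely convergent. Events that are null for the current $(X,\epsilon)$ are null for the next one under $\sigma$ (e.g. the process is stationary). A superscript $[s]$ denotes values $s$ periods later under $\sigma$. Let $\theta=(\theta_0,\theta_1)$, $\eta=\epsilon_0-\epsilon_1$ with CDF $F_\eta$, $p(x)=\Pr(Y=1|X=x)$, and $\phi=(\phi_0,\phi_1)$ with $$\phi_d(X)=(-1)^{d+1}W_d(X)+\sum_{s\ge1}\beta^s\Big\{\mathbb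 E\big[W_d^{[s]}\mathbb 1_{Y^{[s]}=d}\big|X,Y=1\big]-\mathbb E\big[W_d^{[s]}\mathbb 1_{Y^{[s]}=d}\big|X,Y=0\big]\Big\}.$$ **Assumptions.** 1. (Conditional independence) $F_{X',\epsilon'|X,\epsilon,Y}=F_{\epsilon}\times F_{X'|X,Y}$, and the current $\epsilon$ is independent of the current $X$. 2. (Regularity) $\mathbb E|\epsilon_d|<\infty$; for either current action $y$ and $d=0,1$, $\sum_{s\ge 0}\beta^s\,\mathbb E[\|W_d^{[s]}\|\,|X,Y=y]<\infty$ almost surely (the action $y$ being taken now and $\sigma$ being used afterwards); $\mathbb E\|\phi(X)\|<\infty$. 3. The law of $\eta$ has no atoms and has full support $\mathbb R$. 4. $p(X)$ is continuously distributed with support $[\underline p,\overline p]$: it has a density that is zero outside this interval and positive almost everywhere on it. 5. (Contraction) $\beta^2\int_{\underline p}^{\overline p}\int_{\underline p}^{\overline p}\Pi(\tau,p)^2\,d\tau\,dp<1$, where $\Pi(\tau,p)=\sum_{s\ge1}\beta^{s-1}\big[F_{p(X^{[s]})|p(X),Y}(\tau|p,1)-F_{p(X^{[s]})|p(X),Y}(\tau|p,0)\big]$.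 **Theorem.** Let $z(p)=\mathbb E[\phi(X)|p(X)=p]$. For each coordinate $\ell$ consider the Fredholm equation for integrable $b_\ell$ on $[\underline p,\overline p]$, required for almost every $p$ in the interval: $$b_\ell(p)+\sum_{s\ge1}\beta^s\Big\{\mathbb E\Big[\int_{\underline p}^{p(X^{[s]})}b_\ell(\tau)d\tau\Big|p(X)=p,Y=1\Big]-\mathbb E\Big[\int_{\underline p}^{p(X^{[s]})}b_\ell(\tau)d\tau\Big|p(X)=p,Y=0\Big]\Big\}=z_\ell(p).$$ It has at most one solution up to equality almost everywhere, and it has a solution if and only if $z_\ell$ is integrable on $[\underline p,\overline p]$. If $\mathcal B=(b^*_1,\dots,b^*_{k_0+k_1})^\intercal$ is the vector of these solutions, then almost surely $$\Pr(Y=1|X)=F_\eta\big(m(X)^\intercal\theta\big),$$ $$m(X)=\phi(X)-\sum_{s\ge1}\beta^s\Big\{\mathbb E\Big[\int_{\underline p}^{p(X^{[s]})}\mathcal B(\tau)d\tau\Big|X,Y=1\Big]-\mathbb E\Big[\int_{\underline p}^{p(X^{[s]})}\mathcal B(\tau)d\tau\Big|X,Y=0\Big]\Big\}.$$ -/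

import Mathlib

open MeasureTheory ProbabilityTheory Set

noncomputable section

namespace DynamicChoice

/-- A state of the decision problem: the observed state variables `x ∈ ℝᵏ` together with the
pair of action-specific payoff shocks `e = (e 0, e 1)`, which only the agent observes. -/
abbrev State (k : ℕ) : Type := EuclideanSpace ℝ (Fin k) × (Fin 2 → ℝ)

/-- A (measurable) Markov decision rule: an action in `{0, 1}` for every state. -/
abbrev Rule (k : ℕ) : Type := {g : State k → Fin 2 // Measurable g}

/-- A single-agent infinite-horizon binary decision problem with discount factor `β`, known
transformations `W d` of the state variables, structural parameters `θ d`, Markov transition law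
`κ` of `(X', ε')` given `((X, ε), Y)`, together with the law `current` of the current `(X, ε)` and
the decision rule `rule` that the agent follows in every period, `Y = rule (X, ε)`. -/
structure Model (k : ℕ) (kd : Fin 2 → ℕ) where
  β : ℝ
  β_pos : 0 < β
  β_lt_one : β < 1
  W : (d : Fin 2) → EuclideanSpace ℝ (Fin k) → EuclideanSpace ℝ (Fin (kd d))
  measurable_W : ∀ d, Measurable (W d)
  θ : (d : Fin 2) → EuclideanSpace ℝ (Fin (kd d))
  κ : Kernel (State k × Fin 2) (State k)
  markov_κ : IsMarkovKernel κ
  current : Measure (State k)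
  prob_current : IsProbabilityMeasure current
  rule : Rule k

namespace Model

variable {k : ℕ} {kd : Fin 2 → ℕ} (M : Model k kd)

instance : IsMarkovKernel M.κ := M.markov_κ

instance : IsProbabilityMeasure M.current := M.prob_current

/-! ### The decision problem -/

/-- Per-period utility `W_y(x)ᵀ θ_y + e_y` of action `y` in state `(x, e)`. -/
def utility (y : Fin 2) (s : State k) : ℝ :=
  (∑ i, M.W y s.1 i * M.θ y i) + s.2 y

/-- One-period transition of the state when actions are chosen by the rule `g`. -/
def step (g : Rule k) : Kernel (State k) (State k) :=
  M.κ.comap (fun s => (s, g.1 s)) (measurable_id.prodMk g.2)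

instance (g : Rule k) : IsMarkovKernel (M.step g) := by
  unfold step; infer_instance

/-- Law of the state after `t` periods, as a function of the initial state, when the action of
period `j` is chosen by the rule `plan j`. -/
def stateAfter (plan : ℕ → Rule k) : ℕ → Kernel (State k) (State k)
  | 0 => Kernel.id
  | t + 1 => (M.step (plan t)).comp (stateAfter plan t)

instance instMarkovStateAfter (plan : ℕ → Rule k) (t : ℕ) :
    IsMarkovKernel (M.stateAfter plan t) := by
  induction t with
  | zero => unfold stateAfter; infer_instance
  | succ t ih => unfold stateAfter; infer_instance

/-- Expected discounted sum of per-period utilities of a plan from the initial state `s`. -/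
def payoff (plan : ℕ → Rule k) (s : State k) : ℝ :=
  ∑' t : ℕ, M.β ^ t * ∫ s', M.utility ((plan t).1 s') s' ∂(M.stateAfter plan t s)

/-- The expected discounted sum of per-period utilities converges absolutely. -/
def PayoffFinite (plan : ℕ → Rule k) (s : State k) : Prop :=
  ∑' t : ℕ, ENNReal.ofReal (M.β ^ t) *
    ∫⁻ s', ‖M.utility ((plan t).1 s') s'‖ₑ ∂(M.stateAfter plan t s) < ⊤

/-- The plan of using the agent's decision rule in every period. -/
def agentPlan : ℕ → Rule k := fun _ => M.rule

/-- Take action `y` in the current period and use the agent's rule in all later periods. -/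
def actionThenAgent (y : Fin 2) : ℕ → Rule k
  | 0 => ⟨fun _ => y, measurable_const⟩
  | _ + 1 => M.rule

/-- The agent's decision is optimal: in almost every state, the agent's rule maximizes the
expected discounted sum of utilities among all plans for which that sum is well defined. -/
def Optimal : Prop :=
  ∀ᵐ s ∂M.current, M.PayoffFinite M.agentPlan s ∧
    ∀ plan : ℕ → Rule k, M.PayoffFinite plan s → M.payoff plan s ≤ M.payoff M.agentPlan s

/-- Law of the current state variables `X`. -/
def lawX : Measure (EuclideanSpace ℝ (Fin k)) := M.current.map Prod.fst

instance : IsProbabilityMeasure M.lawX :=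
  Measure.isProbabilityMeasure_map measurable_fst.aemeasurable

/-- Law of the current shocks `ε`. -/
def lawShock : Measure (Fin 2 → ℝ) := M.current.map Prod.snd

/-- Law of `η = ε₀ - ε₁`. -/
def lawEta : Measure ℝ := M.lawShock.map (fun e => e 0 - e 1)

/-- The process stays in its support: an event which is null for the current state is null for
the next one. (Stationary processes have this property.) -/
def StaysInSupport : Prop :=
  M.current.bind (M.step M.rule) ≪ M.current

/-! ### Observable objects -/

/-- Joint law of the current state and of the state `s` periods later. -/
def pairLaw (s : ℕ) : Measure (State k × State k) :=
  M.current.compProd (M.stateAfter M.agentPlan s)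

instance (s : ℕ) : IsProbabilityMeasure (M.pairLaw s) := by
  unfold pairLaw; infer_instance

/-- The choice probability `p(x) = Pr(Y = 1 | X = x)`. -/
def choiceProb (x : EuclideanSpace ℝ (Fin k)) : ℝ :=
  (condDistrib M.rule.1 Prod.fst M.current x).real {1}

/-- Conditional law of the state `s` periods later given `(X, Y)`. -/
def condState (s : ℕ) : Kernel (EuclideanSpace ℝ (Fin k) × Fin 2) (State k) :=
  condDistrib (fun ω => ω.2) (fun ω => (ω.1.1, M.rule.1 ω.1)) (M.pairLaw s)

/-- Conditional law of the choice probability `p(X^{[s]})` given `(p(X), Y)`. -/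
def condChoiceProb (s : ℕ) : Kernel (ℝ × Fin 2) ℝ :=
  condDistrib (fun ω => M.choiceProb ω.2.1)
    (fun ω => (M.choiceProb ω.1.1, M.rule.1 ω.1)) (M.pairLaw s)

/-- Coordinate `i` of `φ_d(x) = (-1)^{d+1} W_d + ∑_{s≥1} β^s
{E[W_d^{[s]} 1(Y^{[s]} = d) | X = x, Y = 1] - E[W_d^{[s]} 1(Y^{[s]} = d) | X = x, Y = 0]}`. -/
def phi (d : Fin 2) (i : Fin (kd d)) (x : EuclideanSpace ℝ (Fin k)) : ℝ :=
  (-1) ^ ((d : ℕ) + 1) * M.W d x i +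
    ∑' s : ℕ, M.β ^ (s + 1) *
      ((∫ s', (if M.rule.1 s' = d then M.W d s'.1 i else 0) ∂(M.condState (s + 1) (x, 1))) -
        ∫ s', (if M.rule.1 s' = d then M.W d s'.1 i else 0) ∂(M.condState (s + 1) (x, 0)))

/-- `z(t) = E[φ(X) | p(X) = t]`, coordinate `(d, i)`. -/
def z (d : Fin 2) (i : Fin (kd d)) (t : ℝ) : ℝ :=
  ∫ v, v ∂(condDistrib (M.phi d i) M.choiceProb M.lawX t)

/-- `Π(τ, t; β) = ∑_{s≥1} β^{s-1} [F_{p(X^{[s]})|p(X),Y}(τ|t,1) - F_{p(X^{[s]})|p(X),Y}(τ|t,0)]`. -/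
def kernelPi (τ t : ℝ) : ℝ :=
  ∑' s : ℕ, M.β ^ s *
    (cdf (M.condChoiceProb (s + 1) (t, 1)) τ - cdf (M.condChoiceProb (s + 1) (t, 0)) τ)

/-- `b` is a solution on `[lo, hi]` of the integral equation
`b(t) + ∑_{s≥1} β^s {E[∫_lo^{p(X^{[s]})} b | p(X) = t, Y = 1]
  - E[∫_lo^{p(X^{[s]})} b | p(X) = t, Y = 0]} = z_{d,i}(t)`.
If the conditional laws of the `p(X^{[s]})` have densities, the sum is
`β ∫_lo^hi (∫_lo^{p'} b(τ) dτ) π(p', t; β) dp'`, where `π` is the discounted sum of the differences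
of these densities. -/
def IsBasisSolution (lo hi : ℝ) (d : Fin 2) (i : Fin (kd d)) (b : ℝ → ℝ) : Prop :=
  IntegrableOn b (Icc lo hi) ∧
    ∀ᵐ t ∂(volume.restrict (Icc lo hi)),
      b t + ∑' s : ℕ, M.β ^ (s + 1) *
        ((∫ p', (∫ τ in lo..p', b τ) ∂(M.condChoiceProb (s + 1) (t, 1))) -
          ∫ p', (∫ τ in lo..p', b τ) ∂(M.condChoiceProb (s + 1) (t, 0))) = M.z d i t

/-- Coordinate `(d, i)` of the index `m(x)` built from `φ` and a family `B` of functions. -/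
def index (lo : ℝ) (B : (d : Fin 2) → Fin (kd d) → ℝ → ℝ) (d : Fin 2) (i : Fin (kd d))
    (x : EuclideanSpace ℝ (Fin k)) : ℝ :=
  M.phi d i x -
    ∑' s : ℕ, M.β ^ (s + 1) *
      ((∫ s', (∫ τ in lo..(M.choiceProb s'.1), B d i τ) ∂(M.condState (s + 1) (x, 1))) -
        ∫ s', (∫ τ in lo..(M.choiceProb s'.1), B d i τ) ∂(M.condState (s + 1) (x, 0)))

/-! ### Assumptions -/

/-- Conditional independence: given `(X, ε, Y)`, the pair `(X', ε')` has the product law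
`F_{X'|X,Y} × F_ε`; in particular the shocks are independent of the state variables of the same
period, and this is also so in the current period. -/
def ConditionalIndependence : Prop :=
  (∃ P : Kernel (EuclideanSpace ℝ (Fin k) × Fin 2) (EuclideanSpace ℝ (Fin k)),
    IsMarkovKernel P ∧
      ∀ x e y, M.κ ((x, e), y) = (P (x, y)).prod M.lawShock) ∧
    M.current = M.lawX.prod M.lawShock

/-- Regularity: the shocks are integrable; for either current action, the discounted sum of the
conditional moments `E[‖W_d^{[s]}‖ | X, Y = y]` is finite; and `φ(X)` is integrable. -/
def Regular : Prop :=
  (∀ d : Fin 2, Integrable (fun e : Fin 2 → ℝ => e d) M.lawShock) ∧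
    (∀ d y : Fin 2, ∀ᵐ s ∂M.current,
      ∑' t : ℕ, ENNReal.ofReal (M.β ^ t) *
        ∫⁻ s', ‖M.W d s'.1‖ₑ ∂(M.stateAfter (M.actionThenAgent y) t s) < ⊤) ∧
    ∀ d i, Integrable (M.phi d i) M.lawX

/-- `η` is continuously distributed with full support `ℝ`. -/
def FullSupportShock : Prop :=
  (∀ a, M.lawEta {a} = 0) ∧ M.lawEta.IsOpenPosMeasure

/-- `p(X)` is continuously distributed with support `[lo, hi]`: its law has a density, which
vanishes outside `[lo, hi]` and is positive almost everywhere on `[lo, hi]`. -/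
def ContinuousChoiceProb (lo hi : ℝ) : Prop :=
  M.lawX.map M.choiceProb ≪ volume.restrict (Icc lo hi) ∧
    volume.restrict (Icc lo hi) ≪ M.lawX.map M.choiceProb

/-- `β² ∫∫ Π(τ, t; β)² dτ dt < 1` on `[lo, hi]²`. -/
def Contraction (lo hi : ℝ) : Prop :=
  M.β ^ 2 * ∫ t in Icc lo hi, ∫ τ in Icc lo hi, M.kernelPi τ t ^ 2 < 1

end Model

end DynamicChoice

end

/-!
The proof has an economic half and an analytic half.

*The choice probability determines the quantile of the shocks.* Taking an arbitrary action now and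
following the agent's rule afterwards is one of the plans with which the agent's rule competes, so
the rule selects action `1` exactly if `η = ε₀ - ε₁` does not exceed the gain `δ(x)` of action `1`
over action `0` (`rule_eq_one_iff`); ties have probability zero. Hence `p(x) = F_η(δ(x))`, which
lies strictly between `0` and `1`: conditioning on either action is harmless, and `δ(x) = Q(p(x))` for
the quantile function `Q` of `η`. By conditional independence the later shocks are independent of
the later observed state, and the mean shock to the chosen action in the state `x'` is
`E ε₀ - E[η; η ≤ δ(x')]`. The probability integral transform turns the partial mean into
`∫₀^{p(x')} Q(τ) dτ` (`integral_quantile`), so up to a constant, which the difference between the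
two actions removes, the shocks enter the gain only through the primitive of `Q`:
`Q(p(x)) = φ(x)ᵀθ - ∑ βˢ {E[∫ Q | x, 1] - E[∫ Q | x, 0]}` (`ae_gain_eq`). Because null events stay
null and both actions have positive probability, almost sure facts about the current state may be
used in later periods after either action (`BothActions.ae_later`).

*The integral equation determines `Q` from `θ`.* The action and `X` are conditionally independent
given `p(X)` (`lintegral_current_prob`), so averaging this identity over `X` given `p(X) = t` gives
the integral equation for `Q` with right-hand side `z(t)ᵀθ` (`ae_quantile_fredholm`). Integration by
parts (`integral_truncPrimitive`, `tsum_truncPrimitive_eq`) rewrites the equation as a Fredholm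
equation `b - K b = z` with the bounded kernel `β Π`, whose Hilbert–Schmidt norm is less than one by
the contraction assumption. As the kernel is bounded, `K` maps `L¹` into bounded functions, where
it contracts the `L²` norm; this gives uniqueness in `L¹` (`ae_eq_zero_of_fredholm`) and existence
by a Neumann series (`exists_fredholm_solution`). By linearity and uniqueness `Bᵀθ = Q`, and
inserting this into the identity for `Q(p(x))` yields `m(x)ᵀθ = δ(x)`.
-/

noncomputable section

namespace DynamicChoice

/-! ### Fredholm equations with a bounded square-integrable kernel -/

section Fredholm

variable {α : Type*} [MeasurableSpace α] {ρ : Measure α}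

lemma integrable_kernel_section_mul {K : α → α → ℝ} {C : ℝ}
    (hK : Measurable (Function.uncurry K)) (hC : ∀ t τ, |K t τ| ≤ C) {f : α → ℝ}
    (hf : Integrable f ρ) (t : α) : Integrable (fun τ => K t τ * f τ) ρ :=
  hf.bdd_mul (hK.comp measurable_prodMk_left).aestronglyMeasurable
    (Filter.Eventually.of_forall fun τ => hC t τ)

lemma abs_integral_kernel_mul_le {K : α → α → ℝ} {C : ℝ}
    (hC : ∀ t τ, |K t τ| ≤ C) {f : α → ℝ}
    (hf : Integrable f ρ) (t : α) : |∫ τ, K t τ * f τ ∂ρ| ≤ C * ∫ τ, |f τ| ∂ρ := by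
  rw [← integral_const_mul, ← Real.norm_eq_abs]
  refine norm_integral_le_of_norm_le (hf.abs.const_mul C) (Filter.Eventually.of_forall fun τ => ?_)
  rw [Real.norm_eq_abs, abs_mul]
  exact mul_le_mul_of_nonneg_right (hC t τ) (abs_nonneg _)

variable [IsFiniteMeasure ρ]

lemma abs_integral_le_of_abs_le {f : α → ℝ} {C : ℝ} (hC : ∀ t, |f t| ≤ C) :
    |∫ t, f t ∂ρ| ≤ C * ρ.real univ := by
  rw [← Real.norm_eq_abs]
  exact norm_integral_le_of_norm_le_const (Filter.Eventually.of_forall hC)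

lemma integrable_of_abs_le {f : α → ℝ} {C : ℝ} (hf : AEStronglyMeasurable f ρ)
    (hC : ∀ t, |f t| ≤ C) : Integrable f ρ :=
  Integrable.of_bound hf C (Filter.Eventually.of_forall hC)

lemma stronglyMeasurable_integral_kernel_mul {K : α → α → ℝ}
    (hK : Measurable (Function.uncurry K)) {f : α → ℝ} (hf : AEStronglyMeasurable f ρ) :
    StronglyMeasurable fun t => ∫ τ, K t τ * f τ ∂ρ := by
  have h : ∀ t, ∫ τ, K t τ * f τ ∂ρ = ∫ τ, K t τ * hf.mk f τ ∂ρ := fun t => by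
    refine integral_congr_ae ?_
    filter_upwards [hf.ae_eq_mk] with τ hτ
    rw [hτ]
  simp_rw [h]
  refine StronglyMeasurable.integral_prod_right (f := fun t τ => K t τ * hf.mk f τ) ?_
  exact (hK.mul (hf.stronglyMeasurable_mk.measurable.comp measurable_snd)).stronglyMeasurable

/-- Cauchy–Schwarz for bounded measurable functions on a finite measure space. -/
lemma sq_integral_mul_le {f g : α → ℝ} {C D : ℝ} (hf : AEStronglyMeasurable f ρ)
    (hg : AEStronglyMeasurable g ρ) (hC : ∀ t, |f t| ≤ C) (hD : ∀ t, |g t| ≤ D) :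
    (∫ t, f t * g t ∂ρ) ^ 2 ≤ (∫ t, f t ^ 2 ∂ρ) * ∫ t, g t ^ 2 ∂ρ := by
  have hg1 := integrable_of_abs_le hg hD
  have hf1 := integrable_of_abs_le hf hC
  have hf2 : Integrable (fun t => f t ^ 2) ρ := by
    simp_rw [pow_two]
    exact hf1.bdd_mul hf (Filter.Eventually.of_forall hC)
  have hg2 : Integrable (fun t => g t ^ 2) ρ := by
    simp_rw [pow_two]
    exact hg1.bdd_mul hg (Filter.Eventually.of_forall hD)
  have hfg : Integrable (fun t => f t * g t) ρ := hg1.bdd_mul hf (Filter.Eventually.of_forall hC)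
  have key : ∀ x : ℝ, 0 ≤ (∫ t, f t ^ 2 ∂ρ) * (x * x) + (2 * ∫ t, f t * g t ∂ρ) * x
      + ∫ t, g t ^ 2 ∂ρ := fun x => by
    have h0 : 0 ≤ ∫ t, (x * f t + g t) ^ 2 ∂ρ := integral_nonneg fun t => sq_nonneg _
    have h1 : ∫ t, (x * f t + g t) ^ 2 ∂ρ = (∫ t, f t ^ 2 ∂ρ) * (x * x)
        + (2 * ∫ t, f t * g t ∂ρ) * x + ∫ t, g t ^ 2 ∂ρ := by
      have : (fun t => (x * f t + g t) ^ 2)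
          = fun t => (x * x) * f t ^ 2 + (2 * x) * (f t * g t) + g t ^ 2 := by
        funext t; ring
      have hadd : Integrable (fun t => (x * x) * f t ^ 2 + (2 * x) * (f t * g t)) ρ :=
        (hf2.const_mul _).add (hfg.const_mul _)
      rw [this, integral_add hadd hg2,
        integral_add (hf2.const_mul _) (hfg.const_mul _), integral_const_mul, integral_const_mul]
      ring
    rwa [h1] at h0
  have := discrim_le_zero key
  rw [discrim] at this
  nlinarith

/-- The integral operator of a kernel contracts the `L²` norm by the Hilbert–Schmidt norm. -/
lemma integral_sq_integral_kernel_mul_le {K : α → α → ℝ} {C D : ℝ}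
    (hK : Measurable (Function.uncurry K)) (hC : ∀ t τ, |K t τ| ≤ C) {f : α → ℝ}
    (hf : AEStronglyMeasurable f ρ) (hD : ∀ t, |f t| ≤ D) :
    ∫ t, (∫ τ, K t τ * f τ ∂ρ) ^ 2 ∂ρ ≤
      (∫ t, ∫ τ, K t τ ^ 2 ∂ρ ∂ρ) * ∫ τ, f τ ^ 2 ∂ρ := by
  rw [← integral_mul_const]
  have hN : Integrable (fun t => ∫ τ, K t τ ^ 2 ∂ρ) ρ := by
    refine integrable_of_abs_le (C := C ^ 2 * ρ.real univ) ?_ fun t => ?_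
    · refine (StronglyMeasurable.integral_prod_right (f := fun t τ => K t τ ^ 2)
        ?_).aestronglyMeasurable
      exact (hK.pow_const 2).stronglyMeasurable
    · refine abs_integral_le_of_abs_le fun τ => ?_
      rw [abs_pow]
      exact pow_le_pow_left₀ (abs_nonneg _) (hC t τ) 2
  refine integral_mono_of_nonneg (Filter.Eventually.of_forall fun t => sq_nonneg _)
    (hN.mul_const _) (Filter.Eventually.of_forall fun t => ?_)
  exact sq_integral_mul_le (hK.comp measurable_prodMk_left).aestronglyMeasurable hf (hC t) hD

/-- A homogeneous Fredholm equation of the second kind has no nonzero integrable solution if the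
Hilbert–Schmidt norm of its bounded kernel is less than one: a solution is bounded, hence square
integrable, and the operator is a strict contraction in `L²`. -/
lemma ae_eq_zero_of_fredholm {K : α → α → ℝ} {C : ℝ}
    (hK : Measurable (Function.uncurry K)) (hC : ∀ t τ, |K t τ| ≤ C)
    (hA : ∫ t, ∫ τ, K t τ ^ 2 ∂ρ ∂ρ < 1) {c : α → ℝ} (hc : Integrable c ρ)
    (h : ∀ᵐ t ∂ρ, c t = ∫ τ, K t τ * c τ ∂ρ) : ∀ᵐ t ∂ρ, c t = 0 := by
  set e : α → ℝ := fun t => ∫ τ, K t τ * c τ ∂ρ with he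
  have hem : StronglyMeasurable e := stronglyMeasurable_integral_kernel_mul hK hc.1
  have heb : ∀ t, |e t| ≤ C * ∫ τ, |c τ| ∂ρ := abs_integral_kernel_mul_le hC hc
  -- `c` need not be bounded, but its version `e = K c` is, and solves the equation everywhere.
  have hee : ∀ t, ∫ τ, K t τ * e τ ∂ρ = e t := fun t => by
    refine integral_congr_ae ?_
    filter_upwards [h] with τ hτ
    rw [hτ]
  have h1 := integral_sq_integral_kernel_mul_le (ρ := ρ) hK hC hem.aestronglyMeasurable heb
  simp_rw [hee] at h1
  have h0 : 0 ≤ ∫ t, e t ^ 2 ∂ρ := integral_nonneg fun t => sq_nonneg _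
  have h2 : ∫ t, e t ^ 2 ∂ρ = 0 := by nlinarith
  have hint : Integrable (fun t => e t ^ 2) ρ := by
    refine integrable_of_abs_le (C := (C * ∫ τ, |c τ| ∂ρ) ^ 2)
      (hem.pow 2).aestronglyMeasurable fun t => ?_
    rw [abs_pow]
    exact pow_le_pow_left₀ (abs_nonneg _) (heb t) 2
  rw [integral_eq_zero_iff_of_nonneg (fun t => sq_nonneg _) hint] at h2
  filter_upwards [h2, h] with t ht1 ht2
  rw [ht2]
  exact pow_eq_zero_iff (two_ne_zero) |>.mp ht1

/-- A Fredholm equation of the second kind whose bounded kernel has Hilbert–Schmidt norm less than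
one has an integrable solution for every integrable right-hand side. The Neumann series
`∑ Kⁿ⁺¹ z` converges geometrically in `L²` and, the kernel being bounded, also uniformly. -/
lemma exists_fredholm_solution {K : α → α → ℝ} {C : ℝ}
    (hK : Measurable (Function.uncurry K)) (hC : ∀ t τ, |K t τ| ≤ C)
    (hA : ∫ t, ∫ τ, K t τ ^ 2 ∂ρ ∂ρ < 1) {z : α → ℝ} (hz : Integrable z ρ) :
    ∃ b : α → ℝ, Integrable b ρ ∧ ∀ t, b t - ∫ τ, K t τ * b τ ∂ρ = z t := by
  classical
  set A := ∫ t, ∫ τ, K t τ ^ 2 ∂ρ ∂ρ with hAdef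
  have hA0 : 0 ≤ A := integral_nonneg fun t => integral_nonneg fun τ => sq_nonneg _
  let T : (α → ℝ) → α → ℝ := fun f t => ∫ τ, K t τ * f τ ∂ρ
  -- `z` itself is only integrable; from `T z` on the iterates are bounded.
  let w : ℕ → α → ℝ := fun n => T^[n] (T z)
  have hws : ∀ n, w (n + 1) = T (w n) := fun n => Function.iterate_succ_apply' T n (T z)
  have hw : ∀ n, StronglyMeasurable (w n) ∧ ∃ D, ∀ t, |w n t| ≤ D := by
    intro n
    induction n with
    | zero =>
      exact ⟨stronglyMeasurable_integral_kernel_mul hK hz.1, _, abs_integral_kernel_mul_le hC hz⟩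
    | succ n ih =>
      obtain ⟨hm, D, hD⟩ := ih
      rw [hws]
      have hi : Integrable (w n) ρ :=
        integrable_of_abs_le hm.aestronglyMeasurable hD
      exact ⟨stronglyMeasurable_integral_kernel_mul hK hm.aestronglyMeasurable, _,
        abs_integral_kernel_mul_le hC hi⟩
  have hL2 : ∀ n, ∫ t, w n t ^ 2 ∂ρ ≤ A ^ n * ∫ t, w 0 t ^ 2 ∂ρ := by
    intro n
    induction n with
    | zero => simp
    | succ n ih =>
      obtain ⟨hm, D, hD⟩ := hw n
      rw [hws]
      calc _ ≤ A * ∫ t, w n t ^ 2 ∂ρ :=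
            integral_sq_integral_kernel_mul_le hK hC hm.aestronglyMeasurable hD
        _ ≤ A * (A ^ n * ∫ t, w 0 t ^ 2 ∂ρ) := by gcongr
        _ = _ := by ring
  set S := C ^ 2 * ρ.real univ * ∫ t, w 0 t ^ 2 ∂ρ with hS
  have hS0 : 0 ≤ S := mul_nonneg (mul_nonneg (sq_nonneg _) measureReal_nonneg)
    (integral_nonneg fun t => sq_nonneg _)
  -- Cauchy–Schwarz at a fixed `t` upgrades the `L²` bound on `w n` to a uniform one on `w (n + 1)`.
  have hbound : ∀ n t, |w (n + 1) t| ≤ √S * (√A) ^ n := by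
    intro n t
    obtain ⟨hm, D, hD⟩ := hw n
    have h1 : (w (n + 1) t) ^ 2 ≤ S * A ^ n := by
      rw [hws]
      have hKt : ∫ τ, K t τ ^ 2 ∂ρ ≤ C ^ 2 * ρ.real univ := by
        refine (le_abs_self _).trans ?_
        refine abs_integral_le_of_abs_le fun τ => ?_
        rw [abs_pow]
        exact pow_le_pow_left₀ (abs_nonneg _) (hC t τ) 2
      calc (T (w n) t) ^ 2 ≤ (∫ τ, K t τ ^ 2 ∂ρ) * ∫ τ, w n τ ^ 2 ∂ρ :=
            sq_integral_mul_le (hK.comp measurable_prodMk_left).aestronglyMeasurable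
              hm.aestronglyMeasurable (hC t) hD
        _ ≤ (C ^ 2 * ρ.real univ) * (A ^ n * ∫ t, w 0 t ^ 2 ∂ρ) :=
            mul_le_mul hKt (hL2 n) (integral_nonneg fun t => sq_nonneg _)
              (mul_nonneg (sq_nonneg _) measureReal_nonneg)
        _ = S * A ^ n := by rw [hS]; ring
    have h2 : √(w (n + 1) t ^ 2) ≤ √(S * A ^ n) := Real.sqrt_le_sqrt h1
    have h3 : √(A ^ n) = √A ^ n := by
      rw [Real.sqrt_eq_iff_mul_self_eq (by positivity) (by positivity), ← mul_pow,
        Real.mul_self_sqrt hA0]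
    rwa [Real.sqrt_sq_eq_abs, Real.sqrt_mul hS0, h3] at h2
  have hgeo : Summable fun n => √S * √A ^ n :=
    (summable_geometric_of_lt_one (Real.sqrt_nonneg _) (by
      rw [Real.sqrt_lt' one_pos]; simpa using hA)).mul_left _
  obtain ⟨D0, hD0⟩ := (hw 0).2
  let bd : ℕ → ℝ := fun n => Nat.casesOn n D0 fun n => √S * √A ^ n
  have hbd : ∀ n t, |w n t| ≤ bd n := by
    rintro (_ | n) t
    · exact hD0 t
    · exact hbound n t
  have hbds : Summable bd := (summable_nat_add_iff 1).mp hgeo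
  have hsum : ∀ t, Summable fun n => w n t := fun t =>
    Summable.of_norm_bounded hbds fun n => hbd n t
  let v : α → ℝ := fun t => ∑' n, w n t
  have hv : StronglyMeasurable v := by
    refine stronglyMeasurable_of_tendsto (u := Filter.atTop)
      (f := fun n t => ∑ i ∈ Finset.range n, w i t) ?_ ?_
    · intro n
      exact Finset.stronglyMeasurable_fun_sum _ fun i _ => (hw i).1
    · exact tendsto_pi_nhds.mpr fun t => (hsum t).hasSum.tendsto_sum_nat
  have hvi : Integrable v ρ := by
    refine integrable_of_abs_le (C := ∑' n, bd n) hv.aestronglyMeasurable fun t => ?_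
    rw [← Real.norm_eq_abs]
    exact tsum_of_norm_bounded hbds.hasSum fun n => hbd n t
  refine ⟨fun t => z t + v t, hz.add hvi, fun t => ?_⟩
  have h1 : ∫ τ, K t τ * (z τ + v τ) ∂ρ = T z t + T v t := by
    simp_rw [mul_add]
    exact integral_add (integrable_kernel_section_mul hK hC hz t)
      (integrable_kernel_section_mul hK hC hvi t)
  have h2 : T v t = ∑' n, w (n + 1) t := by
    have hwi : ∀ n, Integrable (w n) ρ := fun n =>
      integrable_of_abs_le (hw n).1.aestronglyMeasurable (hbd n)
    have hC0 : 0 ≤ C := (abs_nonneg _).trans (hC t t)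
    have := integral_tsum_of_summable_integral_norm (μ := ρ)
      (F := fun n τ => K t τ * w n τ)
      (fun n => integrable_kernel_section_mul hK hC (hwi n) t) ?_
    · simp only [T, v]
      simp_rw [← tsum_mul_left]
      rw [← this]
      exact tsum_congr fun n => by rw [hws]
    · refine Summable.of_nonneg_of_le (fun n => integral_nonneg fun τ => norm_nonneg _)
        (fun n => ?_) (hbds.mul_left (C * ρ.real univ))
      refine (le_abs_self _).trans ?_
      have : C * ρ.real univ * bd n = (C * bd n) * ρ.real univ := by ring
      rw [this]
      refine abs_integral_le_of_abs_le fun τ => ?_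
      rw [abs_norm, norm_mul]
      exact mul_le_mul (hC t τ) (hbd n τ) (norm_nonneg _) hC0
  have h3 : v t = T z t + T v t := by
    rw [h2]
    exact (hsum t).tsum_eq_zero_add
  rw [h1, ← h3]
  ring

end Fredholm

/-! ### Primitives of integrable functions -/

section Primitive

/-- The primitive `p ↦ ∫ τ in lo..p, b τ` of a function on `[lo, hi]`, extended to all `p` so that
it is bounded and measurable: only the values of `b` on `[lo, hi]` below `p` count. -/
def truncPrimitive (lo hi : ℝ) (b : ℝ → ℝ) (p : ℝ) : ℝ :=
  ∫ τ in Icc lo hi, (Iio p).indicator b τ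

variable {lo hi : ℝ} {b : ℝ → ℝ}

lemma intervalIntegral_eq_truncPrimitive {p : ℝ} (hp : p ∈ Icc lo hi) :
    ∫ τ in lo..p, b τ = truncPrimitive lo hi b p := by
  rw [truncPrimitive, intervalIntegral.integral_of_le hp.1, integral_indicator measurableSet_Iio,
    Measure.restrict_restrict measurableSet_Iio]
  have : Iio p ∩ Icc lo hi = Ico lo p := by
    ext x
    simp only [mem_inter_iff, mem_Iio, mem_Icc, mem_Ico]
    exact ⟨fun h => ⟨h.2.1, h.1⟩, fun h => ⟨h.2, h.1, h.2.le.trans hp.2⟩⟩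
  rw [this, integral_Ico_eq_integral_Ioc]

lemma truncPrimitive_congr {b' : ℝ → ℝ} (h : ∀ᵐ τ ∂volume.restrict (Icc lo hi), b τ = b' τ) :
    truncPrimitive lo hi b = truncPrimitive lo hi b' := by
  funext p
  refine integral_congr_ae ?_
  filter_upwards [h] with τ hτ
  by_cases hp : τ ∈ Iio p <;> simp [hp, hτ]

lemma measurable_uncurry_indicator_Iio {b : ℝ → ℝ} (hb : Measurable b) :
    Measurable fun x : ℝ × ℝ => (Iio x.1).indicator b x.2 := by
  have : (fun x : ℝ × ℝ => (Iio x.1).indicator b x.2)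
      = {x : ℝ × ℝ | x.2 < x.1}.indicator fun x => b x.2 := by
    funext x
    simp [indicator]
  rw [this]
  exact (hb.comp measurable_snd).indicator (measurableSet_lt measurable_snd measurable_fst)

lemma measurable_truncPrimitive (hb : IntegrableOn b (Icc lo hi)) :
    Measurable (truncPrimitive lo hi b) := by
  have hm := hb.1
  rw [truncPrimitive_congr hm.ae_eq_mk]
  exact (StronglyMeasurable.integral_prod_right
    (f := fun p τ => (Iio p).indicator (hm.mk b) τ)
    (measurable_uncurry_indicator_Iio
      hm.stronglyMeasurable_mk.measurable).stronglyMeasurable).measurable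

lemma abs_truncPrimitive_le (hb : IntegrableOn b (Icc lo hi)) (p : ℝ) :
    |truncPrimitive lo hi b p| ≤ ∫ τ in Icc lo hi, |b τ| := by
  rw [← Real.norm_eq_abs]
  refine norm_integral_le_of_norm_le hb.abs (Filter.Eventually.of_forall fun τ => ?_)
  exact norm_indicator_le_norm_self _ _

lemma truncPrimitive_sum {ι : Type*} (s : Finset ι) (c : ι → ℝ) (f : ι → ℝ → ℝ)
    (hf : ∀ j ∈ s, IntegrableOn (f j) (Icc lo hi)) (p : ℝ) :
    truncPrimitive lo hi (fun τ => ∑ j ∈ s, f j τ * c j) p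
      = ∑ j ∈ s, truncPrimitive lo hi (f j) p * c j := by
  simp only [truncPrimitive]
  have h : ∀ τ, (Iio p).indicator (fun τ => ∑ j ∈ s, f j τ * c j) τ
      = ∑ j ∈ s, (Iio p).indicator (f j) τ * c j := fun τ => by
    by_cases hτ : τ ∈ Iio p <;> simp [hτ]
  simp_rw [h]
  rw [integral_finsetSum _ fun j hj => ?_]
  · simp_rw [integral_mul_const]
  · exact ((hf j hj).indicator measurableSet_Iio).mul_const _

/-- Integration by parts, by Fubini: the mean of a primitive of `b` under a probability measure is
the integral of `b` against the survival function. -/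
lemma integral_truncPrimitive (hb : IntegrableOn b (Icc lo hi)) (C : Measure ℝ)
    [IsProbabilityMeasure C] :
    ∫ p, truncPrimitive lo hi b p ∂C = ∫ τ in Icc lo hi, b τ * (1 - cdf C τ) := by
  have hm := hb.1
  rw [truncPrimitive_congr hm.ae_eq_mk]
  have hb' : IntegrableOn (hm.mk b) (Icc lo hi) := hb.congr hm.ae_eq_mk
  have hmeas := measurable_uncurry_indicator_Iio hm.stronglyMeasurable_mk.measurable
  simp only [truncPrimitive]
  rw [integral_integral_swap]
  · refine integral_congr_ae ?_
    filter_upwards [hm.ae_eq_mk] with τ hτ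
    rw [hτ, cdf_eq_real, ← probReal_compl_eq_one_sub measurableSet_Iic, compl_Iic]
    have : ∀ p, (Iio p).indicator (hm.mk b) τ = (Ioi τ).indicator (fun _ => hm.mk b τ) p :=
      fun p => by simp [indicator]
    simp_rw [this]
    rw [integral_indicator measurableSet_Ioi, setIntegral_const, smul_eq_mul, mul_comm]
  · have hfst : Integrable (fun x : ℝ × ℝ => hm.mk b x.2)
        (C.prod (volume.restrict (Icc lo hi))) := hb'.comp_snd C
    exact hfst.mono hmeas.aestronglyMeasurable
      (Filter.Eventually.of_forall fun x => norm_indicator_le_norm_self _ _)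

end Primitive

/-! ### Quantile functions -/

section Quantile

variable {L : Measure ℝ} [IsProbabilityMeasure L]

lemma strictMono_cdf_of_isOpenPosMeasure [L.IsOpenPosMeasure] : StrictMono (cdf L) := by
  intro a b hab
  rw [cdf_eq_real, cdf_eq_real]
  have h : L.real (Iic b) = L.real (Iic a) + L.real (Ioc a b) := by
    rw [← measureReal_union (by
      rw [Set.disjoint_left]; intro x hx hx'; exact absurd hx'.1 (not_lt.mpr hx)) measurableSet_Ioc,
      Iic_union_Ioc_eq_Iic hab.le]
  have h0 : 0 < L.real (Ioc a b) := by
    refine lt_of_lt_of_le ?_ (measureReal_mono (Ioo_subset_Ioc_self))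
    exact ENNReal.toReal_pos ((isOpen_Ioo.measure_pos L (nonempty_Ioo.mpr hab)).ne')
      (measure_ne_top _ _)
  linarith

lemma continuous_cdf_of_noAtoms (hL : ∀ a, L {a} = 0) : Continuous (cdf L) := by
  rw [continuous_iff_continuousAt]
  intro a
  rw [(monotone_cdf L).continuousAt_iff_leftLim_eq_rightLim, StieltjesFunction.rightLim_eq]
  have h := (cdf L).measure_singleton a
  rw [measure_cdf, hL] at h
  have h2 := ENNReal.ofReal_eq_zero.mp h.symm
  exact le_antisymm ((monotone_cdf L).leftLim_le le_rfl) (by linarith)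

lemma cdf_mem_Ioo [L.IsOpenPosMeasure] (a : ℝ) : cdf L a ∈ Ioo (0 : ℝ) 1 :=
  ⟨(cdf_nonneg L (a - 1)).trans_lt (strictMono_cdf_of_isOpenPosMeasure (by linarith)),
    (strictMono_cdf_of_isOpenPosMeasure (by linarith : a < a + 1)).trans_le (cdf_le_one L _)⟩

lemma exists_cdf_eq (hL : ∀ a, L {a} = 0) {t : ℝ} (ht : t ∈ Ioo (0 : ℝ) 1) :
    ∃ a, cdf L a = t :=
  mem_range_of_exists_le_of_exists_ge (continuous_cdf_of_noAtoms hL)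
    ((tendsto_cdf_atBot L).eventually_le_const ht.1).exists
    ((tendsto_cdf_atTop L).eventually_const_le ht.2).exists

/-- Probability integral transform: a variable with continuous, strictly increasing distribution
function is mapped by this function to a uniform variable. -/
lemma map_cdf [L.IsOpenPosMeasure] (hL : ∀ a, L {a} = 0) :
    L.map (cdf L) = volume.restrict (Ioc 0 1) := by
  have hcm : Measurable (cdf L) := (continuous_cdf_of_noAtoms hL).measurable
  refine Measure.ext_of_Iic _ _ fun t => ?_
  rw [Measure.map_apply hcm measurableSet_Iic, Measure.restrict_apply measurableSet_Iic]
  rcases le_or_gt t 0 with h0 | h0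
  · have h1 : cdf L ⁻¹' Iic t = ∅ := by
      ext x
      simpa using h0.trans_lt (cdf_mem_Ioo x).1
    have h2 : Iic t ∩ Ioc (0 : ℝ) 1 = ∅ := by
      ext x
      simp only [mem_inter_iff, mem_Iic, mem_Ioc, mem_empty_iff_false, iff_false]
      rintro ⟨hx, hx', -⟩
      linarith
    rw [h1, h2, measure_empty, measure_empty]
  rcases le_or_gt 1 t with h1 | h1
  · have h2 : cdf L ⁻¹' Iic t = univ := by
      ext x
      simpa using (cdf_le_one L x).trans h1
    have h3 : Iic t ∩ Ioc (0 : ℝ) 1 = Ioc 0 1 := by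
      ext x
      simp only [mem_inter_iff, mem_Iic, mem_Ioc, and_iff_right_iff_imp]
      exact fun hx => hx.2.trans h1
    simp [h2, h3]
  · obtain ⟨a, ha⟩ := exists_cdf_eq hL ⟨h0, h1⟩
    have h2 : cdf L ⁻¹' Iic t = Iic a := by
      ext x
      rw [← ha]
      exact strictMono_cdf_of_isOpenPosMeasure.le_iff_le
    have h3 : Iic t ∩ Ioc (0 : ℝ) 1 = Ioc 0 t := by
      ext x
      simp only [mem_inter_iff, mem_Iic, mem_Ioc]
      exact ⟨fun hx => ⟨hx.2.1, hx.1⟩, fun hx => ⟨hx.2, hx.1, hx.2.trans h1.le⟩⟩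
    rw [h2, h3, ← ofReal_cdf, ha, Real.volume_Ioc, sub_zero]

/-- The quantile function of a law on `ℝ` with continuous, strictly increasing distribution
function, as a left inverse of that function; its values outside `(0, 1)` are arbitrary. -/
def quantile (L : Measure ℝ) : ℝ → ℝ := Function.invFun (cdf L)

lemma quantile_cdf [L.IsOpenPosMeasure] (a : ℝ) : quantile L (cdf L a) = a :=
  Function.leftInverse_invFun strictMono_cdf_of_isOpenPosMeasure.injective a

lemma measurableEmbedding_cdf [L.IsOpenPosMeasure] (hL : ∀ a, L {a} = 0) :
    MeasurableEmbedding (cdf L) :=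
  (continuous_cdf_of_noAtoms hL).measurableEmbedding
    strictMono_cdf_of_isOpenPosMeasure.injective

lemma integrableOn_quantile [L.IsOpenPosMeasure] (hL : ∀ a, L {a} = 0)
    (hi : Integrable (fun a => a) L) : IntegrableOn (quantile L) (Ioc 0 1) := by
  rw [IntegrableOn, ← map_cdf hL, (measurableEmbedding_cdf hL).integrable_map_iff]
  simpa [Function.comp_def, quantile_cdf] using hi

/-- The primitive of the quantile function at the level `F a` is the partial mean of the law below
`a`. -/
lemma integral_quantile [L.IsOpenPosMeasure] (hL : ∀ a, L {a} = 0) (a : ℝ) :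
    ∫ τ in (0 : ℝ)..cdf L a, quantile L τ = ∫ x in Iic a, x ∂L := by
  have h01 := cdf_mem_Ioo (L := L) a
  have h1 : cdf L ⁻¹' Ioc 0 (cdf L a) = Iic a := by
    ext x
    simp only [mem_preimage, mem_Ioc, mem_Iic, strictMono_cdf_of_isOpenPosMeasure.le_iff_le,
      and_iff_right_iff_imp]
    exact fun _ => (cdf_mem_Ioo x).1
  have h2 : Ioc 0 (cdf L a) ∩ Ioc 0 1 = Ioc 0 (cdf L a) :=
    inter_eq_left.mpr (Ioc_subset_Ioc_right h01.2.le)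
  rw [intervalIntegral.integral_of_le h01.1.le, ← h2, ← Measure.restrict_restrict measurableSet_Ioc,
    ← map_cdf hL, (measurableEmbedding_cdf hL).setIntegral_map, h1]
  simp_rw [quantile_cdf]

lemma truncPrimitive_quantile [L.IsOpenPosMeasure] (hL : ∀ a, L {a} = 0)
    (hint : Integrable (fun a => a) L) {lo hi : ℝ} (h0 : 0 ≤ lo) (h1 : hi ≤ 1) {a : ℝ}
    (ha : cdf L a ∈ Icc lo hi) :
    truncPrimitive lo hi (quantile L) (cdf L a)
      = ∫ x in Iic a, x ∂L - ∫ τ in (0 : ℝ)..lo, quantile L τ := by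
  have hII : ∀ c, 0 ≤ c → c ≤ 1 → IntervalIntegrable (quantile L) volume 0 c := fun c hc hc' => by
    rw [intervalIntegrable_iff_integrableOn_Ioc_of_le hc]
    exact (integrableOn_quantile hL hint).mono_set (Ioc_subset_Ioc_right hc')
  rw [← intervalIntegral_eq_truncPrimitive ha, ← integral_quantile hL a,
    intervalIntegral.integral_interval_sub_left (hII _ (h0.trans ha.1) (ha.2.trans h1))
      (hII _ h0 (ha.1.trans (ha.2.trans h1)))]

end Quantile

/-! ### Joint laws of the process -/

lemma map_compProd_of_comap {α β γ : Type*} [MeasurableSpace α] [MeasurableSpace β]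
    [MeasurableSpace γ] {μ : Measure α} [IsProbabilityMeasure μ] {κ : Kernel α γ}
    [IsMarkovKernel κ] {g : α → β} (hg : Measurable g) {κ' : Kernel β γ} [IsMarkovKernel κ']
    (h : ∀ a, κ a = κ' (g a)) :
    (μ.compProd κ).map (fun ω => (g ω.1, ω.2)) = (μ.map g).compProd κ' := by
  have := Measure.isProbabilityMeasure_map (μ := μ) hg.aemeasurable
  ext S hS
  have hm : Measurable fun ω : α × γ => (g ω.1, ω.2) := by fun_prop
  rw [Measure.map_apply hm hS, Measure.compProd_apply (hm hS), Measure.compProd_apply hS,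
    lintegral_map (Kernel.measurable_kernel_prodMk_left hS) hg]
  simp_rw [h]
  rfl

/-- Joint version of the disintegration of a law along a map `p`. -/
lemma lintegral_condDistrib_id {α : Type*} [MeasurableSpace α] [StandardBorelSpace α] [Nonempty α]
    {μ : Measure α} [IsProbabilityMeasure μ] {p : α → ℝ} (hp : Measurable p)
    {F : ℝ × α → ENNReal} (hF : Measurable F) :
    ∫⁻ x, ∫⁻ x', F (p x, x') ∂(condDistrib id p μ (p x)) ∂μ = ∫⁻ x, F (p x, x) ∂μ := by
  have := Measure.isProbabilityMeasure_map (μ := μ) hp.aemeasurable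
  have h := compProd_map_condDistrib (mβ := inferInstance) (X := p) (Y := id) (μ := μ)
    aemeasurable_id
  have h2 : ∫⁻ ω, F ω ∂((μ.map p).compProd (condDistrib id p μ)) = ∫⁻ x, F (p x, x) ∂μ := by
    rw [h, lintegral_map hF (hp.prodMk measurable_id)]
    rfl
  rw [← h2, Measure.lintegral_compProd hF, lintegral_map _ hp]
  exact hF.lintegral_kernel_prod_right'

namespace Model

variable {k : ℕ} {kd : Fin 2 → ℕ} (M : Model k kd)

instance : IsProbabilityMeasure M.lawShock :=
  Measure.isProbabilityMeasure_map measurable_snd.aemeasurable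

lemma measurable_eta : Measurable fun e : Fin 2 → ℝ => e 0 - e 1 := by fun_prop

instance : IsProbabilityMeasure M.lawEta :=
  Measure.isProbabilityMeasure_map measurable_eta.aemeasurable

lemma measurable_choiceProb : Measurable M.choiceProb :=
  (Kernel.measurable_coe _ (measurableSet_singleton 1)).ennreal_toReal

variable (P : Kernel (EuclideanSpace ℝ (Fin k) × Fin 2) (EuclideanSpace ℝ (Fin k)))
  [IsMarkovKernel P]

/-- Law of the state `s + 1` periods later, as a function of the current observed state and the
current action, when `P` is the transition law of the observed state and the agent's rule is used
after the current period. -/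
def later : ℕ → Kernel (EuclideanSpace ℝ (Fin k) × Fin 2) (State k)
  | 0 => P.prod (Kernel.const _ M.lawShock)
  | s + 1 => (M.step M.rule).comp (later s)

instance instMarkovLater (s : ℕ) : IsMarkovKernel (M.later P s) := by
  induction s with
  | zero => unfold later; infer_instance
  | succ s ih => unfold later; infer_instance

/-- `P` is a transition law of the observed state under which the next state and the next shocks
are independent, and independent of the current shocks. -/
def IsTransition : Prop :=
  ∀ x e y, M.κ ((x, e), y) = (P (x, y)).prod M.lawShock

variable {P}

lemma IsTransition.stateAfter_one (hP : M.IsTransition P) (plan : ℕ → Rule k) (st : State k) :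
    M.stateAfter plan 1 st = M.later P 0 (st.1, (plan 0).1 st) := by
  rw [stateAfter, stateAfter, Kernel.comp_id, later, Kernel.prod_apply, Kernel.const_apply, step,
    Kernel.comap_apply]
  exact hP st.1 st.2 _

lemma IsTransition.stateAfter_succ (hP : M.IsTransition P) (plan : ℕ → Rule k)
    (hplan : ∀ t, plan (t + 1) = M.rule) (s : ℕ) (st : State k) :
    M.stateAfter plan (s + 1) st = M.later P s (st.1, (plan 0).1 st) := by
  induction s with
  | zero => exact hP.stateAfter_one M plan st
  | succ s ih =>
    rw [stateAfter, Kernel.comp_apply, ih, hplan, later, Kernel.comp_apply]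

lemma IsTransition.stateAfter_agentPlan (hP : M.IsTransition P) (s : ℕ) (st : State k) :
    M.stateAfter M.agentPlan (s + 1) st = M.later P s (st.1, M.rule.1 st) :=
  hP.stateAfter_succ M M.agentPlan (fun _ => rfl) s st

lemma IsTransition.stateAfter_actionThenAgent (hP : M.IsTransition P) (y : Fin 2) (s : ℕ)
    (st : State k) :
    M.stateAfter (M.actionThenAgent y) (s + 1) st = M.later P s (st.1, y) :=
  hP.stateAfter_succ M (M.actionThenAgent y) (fun _ => rfl) s st

/-- In every later period the shocks are independent of the observed state of that period. -/
lemma IsTransition.later_eq_prod (hP : M.IsTransition P) (s : ℕ)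
    (a : EuclideanSpace ℝ (Fin k) × Fin 2) :
    M.later P s a = ((M.later P s a).map Prod.fst).prod M.lawShock := by
  have key : ∀ ρ : Measure (EuclideanSpace ℝ (Fin k)), IsProbabilityMeasure ρ →
      ρ.prod M.lawShock = ((ρ.prod M.lawShock).map Prod.fst).prod M.lawShock := fun ρ hρ => by
    rw [Measure.map_fst_prod, measure_univ, one_smul]
  cases s with
  | zero =>
    rw [later, Kernel.prod_apply, Kernel.const_apply]
    exact key _ inferInstance
  | succ s =>
    have hstep : M.later P (s + 1) a
        = (((M.later P s a).map fun st => (st.1, M.rule.1 st)).bind P).prod M.lawShock := by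
      have hg : Measurable fun st : State k => (st.1, M.rule.1 st) :=
        measurable_fst.prodMk M.rule.2
      rw [later, Kernel.comp_apply]
      ext S hS
      rw [Measure.bind_apply hS (Kernel.aemeasurable _), Measure.prod_apply hS,
        Measure.lintegral_bind (Kernel.aemeasurable _)
          (measurable_measure_prodMk_left hS).aemeasurable,
        lintegral_map _ hg]
      · refine lintegral_congr fun st => ?_
        rw [step, Kernel.comap_apply]
        have := hP st.1 st.2 (M.rule.1 st)
        rw [Prod.mk.eta] at this
        rw [this, Measure.prod_apply hS]
      · exact (measurable_measure_prodMk_left hS).lintegral_kernel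
    have := Measure.isProbabilityMeasure_map (μ := M.later P s a)
      (measurable_fst.prodMk M.rule.2).aemeasurable
    rw [hstep]
    exact key _ inferInstance

/-- Both actions are chosen with positive probability in almost every observed state: for neither
action do the shocks avoid it almost surely. -/
def BothActions : Prop :=
  ∀ᵐ x ∂M.lawX, ∀ y, ∃ᶠ e in ae M.lawShock, M.rule.1 (x, e) = y

variable {M}

/-- If a property of `(X, Y)` holds almost surely and both actions have positive conditional
probability, then it holds for almost every `X` and both actions. -/
lemma BothActions.ae_forall (hb : M.BothActions) (hprod : M.current = M.lawX.prod M.lawShock)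
    {A : EuclideanSpace ℝ (Fin k) → Fin 2 → Prop}
    (h : ∀ᵐ st ∂M.current, A st.1 (M.rule.1 st)) : ∀ᵐ x ∂M.lawX, ∀ y, A x y := by
  rw [hprod] at h
  filter_upwards [Measure.ae_ae_of_ae_prod h, hb] with x hx hbx y
  obtain ⟨e, he, hA⟩ := ((hbx y).and_eventually hx).exists
  simpa [he] using hA

lemma ae_lawX_of_ae_current {A : EuclideanSpace ℝ (Fin k) → Prop}
    (hprod : M.current = M.lawX.prod M.lawShock)
    (h : ∀ᵐ st ∂M.current, A st.1) : ∀ᵐ x ∂M.lawX, A x := by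
  rw [hprod] at h
  filter_upwards [Measure.ae_ae_of_ae_prod h] with x hx
  exact hx.exists.choose_spec

lemma ae_current_of_ae_lawX {A : EuclideanSpace ℝ (Fin k) → Prop}
    (h : ∀ᵐ x ∂M.lawX, A x) : ∀ᵐ st ∂M.current, A st.1 :=
  ae_of_ae_map measurable_fst.aemeasurable h

/-- Events that are null for the current state are null in every later period, not only in the
next one. -/
lemma bind_stateAfter_absolutelyContinuous (h_supp : M.StaysInSupport) (s : ℕ) :
    M.current.bind (M.stateAfter M.agentPlan s) ≪ M.current := by
  induction s with
  | zero =>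
    rw [stateAfter]
    rw [Measure.id_comp]
  | succ s ih =>
    rw [stateAfter, ← Measure.comp_assoc]
    exact (ih.comp_right _).trans h_supp

lemma ae_stateAfter (h_supp : M.StaysInSupport) {A : State k → Prop}
    (h : ∀ᵐ st ∂M.current, A st) (s : ℕ) :
    ∀ᵐ st ∂M.current, ∀ᵐ st' ∂(M.stateAfter M.agentPlan s st), A st' :=
  Measure.ae_ae_of_ae_comp ((bind_stateAfter_absolutelyContinuous h_supp s).ae_le h)

/-- A property which holds almost surely for the current state holds almost surely in every later
period, for almost every current `X` and after either action, also the one which the agent does not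
choose. -/
lemma BothActions.ae_later (hb : M.BothActions) (hprod : M.current = M.lawX.prod M.lawShock)
    (h_supp : M.StaysInSupport) (hP : M.IsTransition P) {A : State k → Prop}
    (h : ∀ᵐ st ∂M.current, A st) :
    ∀ᵐ x ∂M.lawX, ∀ s y, ∀ᵐ st' ∂(M.later P s (x, y)), A st' := by
  rw [ae_all_iff]
  intro s
  refine hb.ae_forall hprod (A := fun x y => ∀ᵐ st' ∂(M.later P s (x, y)), A st') ?_
  filter_upwards [ae_stateAfter h_supp h (s + 1)] with st hst
  rwa [hP.stateAfter_agentPlan] at hst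

lemma pairLaw_map_state_action (s : ℕ) :
    (M.pairLaw s).map (fun ω => (ω.1.1, M.rule.1 ω.1))
      = M.current.map fun st => (st.1, M.rule.1 st) := by
  have hg : Measurable fun st : State k => (st.1, M.rule.1 st) := measurable_fst.prodMk M.rule.2
  have : (fun ω : State k × State k => (ω.1.1, M.rule.1 ω.1))
      = (fun st : State k => (st.1, M.rule.1 st)) ∘ Prod.fst := rfl
  rw [this, ← Measure.map_map hg measurable_fst, pairLaw]
  congr 1
  exact Measure.fst_compProd _ _

/-- The conditional law of a later state given `(X, Y)` is the one obtained by iterating the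
transition law. -/
lemma BothActions.condState_eq (hb : M.BothActions) (hprod : M.current = M.lawX.prod M.lawShock)
    (hP : M.IsTransition P) :
    ∀ᵐ x ∂M.lawX, ∀ s y, M.condState (s + 1) (x, y) = M.later P s (x, y) := by
  rw [ae_all_iff]
  intro s
  refine hb.ae_forall hprod (A := fun x y => M.condState (s + 1) (x, y) = M.later P s (x, y)) ?_
  have hg : Measurable fun st : State k => (st.1, M.rule.1 st) := measurable_fst.prodMk M.rule.2
  have h := condDistrib_ae_eq_of_measure_eq_compProd (μ := M.pairLaw (s + 1))
    (fun ω : State k × State k => (ω.1.1, M.rule.1 ω.1)) (Y := fun ω => ω.2)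
    (κ := M.later P s) measurable_snd.aemeasurable (by
      rw [pairLaw_map_state_action]
      exact map_compProd_of_comap hg fun st => hP.stateAfter_agentPlan M s st)
  rw [pairLaw_map_state_action] at h
  exact ae_of_ae_map hg.aemeasurable h

/-- Given `X = x`, the action is the image of the shocks under the rule. -/
lemma condDistrib_rule (hprod : M.current = M.lawX.prod M.lawShock) :
    ∀ᵐ x ∂M.lawX, condDistrib M.rule.1 Prod.fst M.current x
      = M.lawShock.map fun e => M.rule.1 (x, e) := by
  let κ : Kernel (EuclideanSpace ℝ (Fin k)) (Fin 2) :=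
    (Kernel.id.prod (Kernel.const _ M.lawShock)).map M.rule.1
  have hκ : ∀ x, κ x = M.lawShock.map fun e => M.rule.1 (x, e) := fun x => by
    simp only [κ]
    rw [Kernel.map_apply _ M.rule.2, Kernel.prod_apply, Kernel.id_apply, Kernel.const_apply,
      Measure.dirac_prod, Measure.map_map M.rule.2 measurable_prodMk_left]
    rfl
  have hm : IsMarkovKernel κ := Kernel.IsMarkovKernel.map _ M.rule.2
  have h := condDistrib_ae_eq_of_measure_eq_compProd (μ := M.current)
    (Prod.fst : State k → _) (Y := M.rule.1) (κ := κ) M.rule.2.aemeasurable (by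
      change _ = M.lawX.compProd κ
      rw [hprod]
      have hpm : Measurable fun st : State k => (st.1, M.rule.1 st) :=
        measurable_fst.prodMk M.rule.2
      ext S hS
      rw [Measure.map_apply hpm hS, Measure.compProd_apply hS, Measure.prod_apply (hpm hS)]
      refine lintegral_congr fun x => ?_
      have hr : Measurable fun e => M.rule.1 (x, e) := M.rule.2.comp measurable_prodMk_left
      rw [hκ, Measure.map_apply hr (measurable_prodMk_left hS)]
      rfl)
  filter_upwards [h] with x hx
  rw [hx, hκ]

/-- Conditional probability of the action `y` given that the choice probability is `t`, for `t` in
`[0, 1]`. -/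
def actionWeight (y : Fin 2) (t : ℝ) : ENNReal :=
  if y = 1 then ENNReal.ofReal t else 1 - ENNReal.ofReal t

lemma measurable_actionWeight (y : Fin 2) : Measurable (actionWeight y) := by
  unfold actionWeight
  split_ifs
  · exact ENNReal.measurable_ofReal
  · exact measurable_const.sub ENNReal.measurable_ofReal

lemma measure_rule_eq (hprod : M.current = M.lawX.prod M.lawShock) :
    ∀ᵐ x ∂M.lawX, ∀ y,
      M.lawShock {e | M.rule.1 (x, e) = y} = actionWeight y (M.choiceProb x) := by
  filter_upwards [condDistrib_rule hprod] with x hx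
  have hr : Measurable fun e => M.rule.1 (x, e) := M.rule.2.comp measurable_prodMk_left
  have h1 : M.lawShock {e | M.rule.1 (x, e) = 1} = ENNReal.ofReal (M.choiceProb x) := by
    rw [choiceProb, hx, measureReal_def, Measure.map_apply hr (measurableSet_singleton _),
      ENNReal.ofReal_toReal (measure_ne_top _ _)]
    rfl
  intro y
  by_cases hy : y = 1
  · subst hy
    simpa [actionWeight] using h1
  · have hm : MeasurableSet {e | M.rule.1 (x, e) = 1} := hr (measurableSet_singleton 1)
    rw [actionWeight, if_neg hy, ← h1, ← prob_compl_eq_one_sub hm]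
    congr 1
    ext e
    simp only [mem_ofPred_eq, mem_compl_iff]
    omega

lemma choiceProb_mem_Icc (x : EuclideanSpace ℝ (Fin k)) : M.choiceProb x ∈ Icc (0 : ℝ) 1 :=
  ⟨measureReal_nonneg, measureReal_le_one⟩

lemma bothActions_of_choiceProb (hprod : M.current = M.lawX.prod M.lawShock)
    (h : ∀ᵐ x ∂M.lawX, M.choiceProb x ∈ Ioo (0 : ℝ) 1) : M.BothActions := by
  filter_upwards [measure_rule_eq hprod, h] with x hx hpx y
  rw [frequently_ae_iff, hx y, actionWeight]
  split_ifs
  · simpa using hpx.1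
  · rw [Ne, tsub_eq_zero_iff_le, not_le]
    exact ENNReal.ofReal_lt_one.mpr hpx.2

lemma lintegral_current (hprod : M.current = M.lawX.prod M.lawShock)
    {f : EuclideanSpace ℝ (Fin k) × Fin 2 → ENNReal} (hf : Measurable f) :
    ∫⁻ st, f (st.1, M.rule.1 st) ∂M.current
      = ∑ y : Fin 2, ∫⁻ x, actionWeight y (M.choiceProb x) * f (x, y) ∂M.lawX := by
  have hw : ∀ y, Measurable fun x => actionWeight y (M.choiceProb x) * f (x, y) := fun y =>
    ((measurable_actionWeight y).comp M.measurable_choiceProb).mul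
      (hf.comp measurable_prodMk_right)
  have hfr : Measurable fun st : State k => f (st.1, M.rule.1 st) :=
    hf.comp (measurable_fst.prodMk M.rule.2)
  rw [hprod, lintegral_prod _ hfr.aemeasurable,
    ← lintegral_finsetSum _ fun y _ => hw y]
  refine lintegral_congr_ae ?_
  filter_upwards [measure_rule_eq hprod] with x hx
  have hr : Measurable fun e => M.rule.1 (x, e) := M.rule.2.comp measurable_prodMk_left
  have : ∫⁻ e, f (x, M.rule.1 (x, e)) ∂M.lawShock
      = ∫⁻ y, f (x, y) ∂(M.lawShock.map fun e => M.rule.1 (x, e)) :=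
    (lintegral_map (hf.comp measurable_prodMk_left) hr).symm
  rw [this, lintegral_fintype]
  refine Finset.sum_congr rfl fun y _ => ?_
  rw [Measure.map_apply hr (measurableSet_singleton _), ← hx y, mul_comm]
  rfl

set_option linter.unusedSectionVars false

/-! ### Discounted sums of later conditional means -/

variable (M P)

/-- After either action in the observed state `x`, the discounted sum of the later conditional
means of `f` converges absolutely. -/
def DiscountedFinite (f : State k → ℝ) (x : EuclideanSpace ℝ (Fin k)) : Prop :=
  ∀ y, (∀ s, Integrable f (M.later P s (x, y))) ∧
    Summable fun s => M.β ^ (s + 1) * ∫ st, |f st| ∂(M.later P s (x, y))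

/-- The discounted sum of the effects of the current action on the later conditional means
of `f`: `∑_{s≥1} β^s {E[f^{[s]} | x, Y = 1] - E[f^{[s]} | x, Y = 0]}`. -/
def effect (f : State k → ℝ) (x : EuclideanSpace ℝ (Fin k)) : ℝ :=
  ∑' s : ℕ, M.β ^ (s + 1) *
    ((∫ st, f st ∂(M.later P s (x, 1))) - ∫ st, f st ∂(M.later P s (x, 0)))

variable {M P}

lemma pow_β_nonneg (n : ℕ) : 0 ≤ M.β ^ n := pow_nonneg M.β_pos.le n

lemma summable_pow_β : Summable fun s : ℕ => M.β ^ (s + 1) :=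
  (summable_nat_add_iff 1).mpr (summable_geometric_of_lt_one M.β_pos.le M.β_lt_one)

namespace DiscountedFinite

variable {f g : State k → ℝ} {x : EuclideanSpace ℝ (Fin k)}

lemma summable (hf : M.DiscountedFinite P f x) (y : Fin 2) :
    Summable fun s => M.β ^ (s + 1) * ∫ st, f st ∂(M.later P s (x, y)) := by
  refine Summable.of_norm_bounded (hf y).2 fun s => ?_
  rw [norm_mul, Real.norm_of_nonneg (pow_β_nonneg _)]
  exact mul_le_mul_of_nonneg_left (norm_integral_le_integral_norm _) (pow_β_nonneg _)

lemma effect_eq (hf : M.DiscountedFinite P f x) :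
    M.effect P f x = ∑' s, M.β ^ (s + 1) * ∫ st, f st ∂(M.later P s (x, 1))
      - ∑' s, M.β ^ (s + 1) * ∫ st, f st ∂(M.later P s (x, 0)) := by
  rw [effect, ← (hf.summable 1).tsum_sub (hf.summable 0)]
  simp_rw [mul_sub]

lemma of_abs_le (hg : M.DiscountedFinite P g x) (hf : Measurable f) (h : ∀ st, |f st| ≤ g st) :
    M.DiscountedFinite P f x := by
  intro y
  have hi : ∀ s, Integrable f (M.later P s (x, y)) := fun s =>
    ((hg y).1 s).mono' hf.aestronglyMeasurable (Filter.Eventually.of_forall h)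
  refine ⟨hi, Summable.of_nonneg_of_le
    (fun s => mul_nonneg (pow_β_nonneg _) (integral_nonneg fun _ => abs_nonneg _)) (fun s => ?_)
    (hg y).2⟩
  refine mul_le_mul_of_nonneg_left (integral_mono (hi s).abs ((hg y).1 s).abs fun st => ?_)
    (pow_β_nonneg _)
  exact (h st).trans (le_abs_self _)

lemma of_integral_abs_le {C : ℝ} (hf : ∀ s y, Integrable f (M.later P s (x, y)))
    (h : ∀ s y, ∫ st, |f st| ∂(M.later P s (x, y)) ≤ C) : M.DiscountedFinite P f x := by
  refine fun y => ⟨fun s => hf s y, Summable.of_nonneg_of_le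
    (fun s => mul_nonneg (pow_β_nonneg _) (integral_nonneg fun _ => abs_nonneg _)) (fun s => ?_)
    ((summable_pow_β (M := M)).mul_right C)⟩
  exact mul_le_mul_of_nonneg_left (h s y) (pow_β_nonneg _)

lemma of_bounded {C : ℝ} (hf : Measurable f) (h : ∀ st, |f st| ≤ C) :
    M.DiscountedFinite P f x := by
  refine of_integral_abs_le (C := C)
    (fun s y => integrable_of_abs_le hf.aestronglyMeasurable h) fun s y => ?_
  refine (le_abs_self _).trans ((abs_integral_le_of_abs_le (C := C) fun st => ?_).trans_eq ?_)
  · rw [abs_abs]; exact h st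
  · simp

lemma add (hf : M.DiscountedFinite P f x) (hg : M.DiscountedFinite P g x) :
    M.DiscountedFinite P (fun st => f st + g st) x := by
  refine fun y => ⟨fun s => ((hf y).1 s).add ((hg y).1 s), Summable.of_nonneg_of_le
    (fun s => mul_nonneg (pow_β_nonneg _) (integral_nonneg fun _ => abs_nonneg _)) (fun s => ?_)
    ((hf y).2.add (hg y).2)⟩
  rw [← mul_add, ← integral_add ((hf y).1 s).abs ((hg y).1 s).abs]
  exact mul_le_mul_of_nonneg_left (integral_mono (((hf y).1 s).add ((hg y).1 s)).abs
    (((hf y).1 s).abs.add ((hg y).1 s).abs) fun st => abs_add_le _ _) (pow_β_nonneg _)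

lemma mul_const (hf : M.DiscountedFinite P f x) (c : ℝ) :
    M.DiscountedFinite P (fun st => f st * c) x := by
  refine fun y => ⟨fun s => ((hf y).1 s).mul_const c, ?_⟩
  simp_rw [abs_mul, integral_mul_const, ← mul_assoc]
  exact (hf y).2.mul_right _

lemma sum {ι : Type*} {u : Finset ι} {F : ι → State k → ℝ}
    (hF : ∀ j ∈ u, M.DiscountedFinite P (F j) x) :
    M.DiscountedFinite P (fun st => ∑ j ∈ u, F j st) x := by
  classical
  induction u using Finset.induction_on with
  | empty => simpa using of_bounded (C := 0) measurable_const (by simp)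
  | insert j u hj ih =>
    simp_rw [Finset.sum_insert hj]
    exact (hF j (by simp)).add (ih fun i hi => hF i (by simp [hi]))

lemma effect_add (hf : M.DiscountedFinite P f x) (hg : M.DiscountedFinite P g x) :
    M.effect P (fun st => f st + g st) x = M.effect P f x + M.effect P g x := by
  rw [(hf.add hg).effect_eq, hf.effect_eq, hg.effect_eq]
  have h : ∀ y, ∑' s, M.β ^ (s + 1) * ∫ st, (f st + g st) ∂(M.later P s (x, y))
      = ∑' s, M.β ^ (s + 1) * ∫ st, f st ∂(M.later P s (x, y))
        + ∑' s, M.β ^ (s + 1) * ∫ st, g st ∂(M.later P s (x, y)) := fun y => by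
    rw [← (hf.summable y).tsum_add (hg.summable y)]
    refine tsum_congr fun s => ?_
    rw [integral_add ((hf y).1 s) ((hg y).1 s), mul_add]
  rw [h, h]
  ring

end DiscountedFinite

lemma effect_mul_const (f : State k → ℝ) (c : ℝ) (x : EuclideanSpace ℝ (Fin k)) :
    M.effect P (fun st => f st * c) x = M.effect P f x * c := by
  simp_rw [effect, integral_mul_const, ← sub_mul, ← mul_assoc]
  exact tsum_mul_right

lemma effect_const (c : ℝ) (x : EuclideanSpace ℝ (Fin k)) :
    M.effect P (fun _ => c) x = 0 := by
  simp [effect]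

lemma effect_sum {ι : Type*} {u : Finset ι} {F : ι → State k → ℝ}
    {x : EuclideanSpace ℝ (Fin k)} (hF : ∀ j ∈ u, M.DiscountedFinite P (F j) x) :
    M.effect P (fun st => ∑ j ∈ u, F j st) x = ∑ j ∈ u, M.effect P (F j) x := by
  classical
  induction u using Finset.induction_on with
  | empty => simpa using effect_const 0 x
  | insert j u hj ih =>
    simp_rw [Finset.sum_insert hj]
    rw [(hF j (by simp)).effect_add (DiscountedFinite.sum fun i hi => hF i (by simp [hi])),
      ih fun i hi => hF i (by simp [hi])]

lemma effect_congr {f g : State k → ℝ} {x : EuclideanSpace ℝ (Fin k)}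
    (h : ∀ s y, ∫ st, f st ∂(M.later P s (x, y)) = ∫ st, g st ∂(M.later P s (x, y))) :
    M.effect P f x = M.effect P g x := by
  simp_rw [effect, h]

lemma abs_effect_le {f : State k → ℝ} {C : ℝ} (h : ∀ st, |f st| ≤ C)
    (x : EuclideanSpace ℝ (Fin k)) :
    |M.effect P f x| ≤ ∑' s : ℕ, M.β ^ (s + 1) * (2 * C) := by
  rw [← Real.norm_eq_abs]
  refine tsum_of_norm_bounded (summable_pow_β.mul_right _).hasSum fun s => ?_
  rw [norm_mul, Real.norm_of_nonneg (pow_β_nonneg _)]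
  refine mul_le_mul_of_nonneg_left ?_ (pow_β_nonneg _)
  have hy : ∀ y, |∫ st, f st ∂(M.later P s (x, y))| ≤ C := fun y =>
    (abs_integral_le_of_abs_le h).trans_eq (by simp)
  rw [Real.norm_eq_abs]
  exact (abs_sub _ _).trans (by linarith [hy 0, hy 1])

lemma measurable_effect {f : State k → ℝ} {C : ℝ} (hf : Measurable f) (h : ∀ st, |f st| ≤ C) :
    Measurable (M.effect P f) := by
  have hs : ∀ x, Summable fun s : ℕ => M.β ^ (s + 1) *
      ((∫ st, f st ∂(M.later P s (x, 1))) - ∫ st, f st ∂(M.later P s (x, 0))) := fun x => by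
    have hfin := DiscountedFinite.of_bounded (M := M) (P := P) (x := x) hf h
    simp_rw [mul_sub]
    exact (hfin.summable 1).sub (hfin.summable 0)
  have hm : ∀ s y, Measurable fun x => ∫ st, f st ∂(M.later P s (x, y)) := fun s y =>
    (hf.stronglyMeasurable.integral_kernel (κ := M.later P s)).measurable.comp
      measurable_prodMk_right
  refine measurable_of_tendsto_metrizable (f := fun n x => ∑ s ∈ Finset.range n, M.β ^ (s + 1) *
      ((∫ st, f st ∂(M.later P s (x, 1))) - ∫ st, f st ∂(M.later P s (x, 0)))) (fun n => ?_)
    (tendsto_pi_nhds.mpr fun x => (hs x).hasSum.tendsto_sum_nat)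
  exact Finset.measurable_fun_sum _ fun s _ => ((hm s 1).sub (hm s 0)).const_mul _

/-! ### Utilities and shocks -/

variable (M) in
/-- Coordinate `i` of `W_d`, counted when the agent's rule selects action `d`. -/
def chosenW (d : Fin 2) (i : Fin (kd d)) (st : State k) : ℝ :=
  if M.rule.1 st = d then M.W d st.1 i else 0

variable (M) in
/-- The shock to the utility of the action which the agent's rule selects. -/
def chosenShock (st : State k) : ℝ := st.2 (M.rule.1 st)

variable (M) in
lemma measurable_W_apply (d : Fin 2) (i : Fin (kd d)) : Measurable fun x => M.W d x i :=
  (measurable_pi_apply i).comp ((PiLp.continuous_ofLp 2 _).measurable.comp (M.measurable_W d))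

lemma measurable_chosenW (d : Fin 2) (i : Fin (kd d)) : Measurable (M.chosenW d i) := by
  refine Measurable.ite (M.rule.2 (measurableSet_singleton d)) ?_ measurable_const
  exact (M.measurable_W_apply d i).comp measurable_fst

lemma chosenShock_eq (st : State k) :
    M.chosenShock st = if M.rule.1 st = 1 then st.2 1 else st.2 0 := by
  unfold chosenShock
  split_ifs with h
  · rw [h]
  · rw [show M.rule.1 st = 0 by omega]

variable (M) in
lemma measurable_chosenShock : Measurable M.chosenShock := by
  have : M.chosenShock = fun st => if M.rule.1 st = 1 then st.2 1 else st.2 0 :=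
    funext chosenShock_eq
  rw [this]
  exact Measurable.ite (M.rule.2 (measurableSet_singleton 1)) (by fun_prop) (by fun_prop)

lemma utility_rule (st : State k) :
    M.utility (M.rule.1 st) st
      = (∑ d : Fin 2, ∑ i, M.chosenW d i st * M.θ d i) + M.chosenShock st := by
  unfold utility chosenShock chosenW
  congr 1
  rw [Finset.sum_eq_single (M.rule.1 st)]
  · simp
  · intro d _ hd
    simp [hd.symm]
  · simp

/-- Conditionally on the later observed states, the shocks keep their unconditional law. -/
lemma integral_later (hP : M.IsTransition P) {f : State k → ℝ} {s : ℕ}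
    {a : EuclideanSpace ℝ (Fin k) × Fin 2} (hf : Integrable f (M.later P s a)) :
    ∫ st, f st ∂(M.later P s a)
      = ∫ st, (∫ e, f (st.1, e) ∂M.lawShock) ∂(M.later P s a) := by
  have hi : IsProbabilityMeasure ((M.later P s a).map Prod.fst) :=
    Measure.isProbabilityMeasure_map measurable_fst.aemeasurable
  have h := hP.later_eq_prod M s a
  rw [h] at hf
  calc ∫ st, f st ∂(M.later P s a)
      = ∫ st, f st ∂(((M.later P s a).map Prod.fst).prod M.lawShock) := by rw [← h]
    _ = ∫ x, (∫ e, f (x, e) ∂M.lawShock) ∂((M.later P s a).map Prod.fst) := integral_prod _ hf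
    _ = _ := integral_map measurable_fst.aemeasurable hf.1.integral_prod_right'

lemma map_snd_later (hP : M.IsTransition P) (s : ℕ) (a : EuclideanSpace ℝ (Fin k) × Fin 2) :
    (M.later P s a).map Prod.snd = M.lawShock := by
  have hi : IsProbabilityMeasure ((M.later P s a).map Prod.fst) :=
    Measure.isProbabilityMeasure_map measurable_fst.aemeasurable
  rw [hP.later_eq_prod M s a, Measure.map_snd_prod, measure_univ, one_smul]

lemma discountedFinite_chosenShock (hP : M.IsTransition P)
    (hint : ∀ d : Fin 2, Integrable (fun e : Fin 2 → ℝ => e d) M.lawShock)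
    (x : EuclideanSpace ℝ (Fin k)) : M.DiscountedFinite P M.chosenShock x := by
  have hi : ∀ d s y, Integrable (fun st : State k => |st.2 d|) (M.later P s (x, y)) := by
    intro d s y
    have h := (hint d).abs
    rw [← map_snd_later hP s (x, y)] at h
    exact h.comp_measurable measurable_snd
  have hd : ∀ d, M.DiscountedFinite P (fun st => |st.2 d|) x := fun d => by
    refine DiscountedFinite.of_integral_abs_le (C := ∫ e, |e d| ∂M.lawShock)
      (fun s y => hi d s y) fun s y => ?_
    simp_rw [abs_abs]
    conv_rhs => rw [← map_snd_later hP s (x, y)]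
    have habs : Measurable fun e : Fin 2 → ℝ => |e d| := (measurable_pi_apply d).abs
    rw [integral_map measurable_snd.aemeasurable habs.aestronglyMeasurable]
  refine ((hd 0).add (hd 1)).of_abs_le M.measurable_chosenShock fun st => ?_
  rw [chosenShock_eq]
  split_ifs
  · linarith [abs_nonneg (st.2 0)]
  · linarith [abs_nonneg (st.2 1)]

/-- Absolute convergence of the discounted sums in the form of the regularity assumption, at an
observed state. -/
lemma discountedFinite_norm_W (hP : M.IsTransition P) {d : Fin 2} {st : State k}
    (h : ∀ y : Fin 2, ∑' t : ℕ, ENNReal.ofReal (M.β ^ t) *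
        ∫⁻ s', ‖M.W d s'.1‖ₑ ∂(M.stateAfter (M.actionThenAgent y) t st) < ⊤) :
    M.DiscountedFinite P (fun s' => ‖M.W d s'.1‖) st.1 := by
  intro y
  have hsum : ∑' t : ℕ, ENNReal.ofReal (M.β ^ (t + 1)) *
      ∫⁻ s', ‖M.W d s'.1‖ₑ ∂(M.later P t (st.1, y)) ≠ ⊤ := by
    simp_rw [← hP.stateAfter_actionThenAgent M y _ st]
    exact ((ENNReal.tsum_comp_le_tsum_of_injective (add_left_injective 1) _).trans_lt (h y)).ne
  have hWm : Measurable fun s' : State k => ‖M.W d s'.1‖ :=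
    ((M.measurable_W d).comp measurable_fst).norm
  have hi : ∀ s, Integrable (fun s' : State k => ‖M.W d s'.1‖) (M.later P s (st.1, y)) := by
    intro s
    refine ⟨hWm.aestronglyMeasurable, ?_⟩
    have h1 := ENNReal.ne_top_of_tsum_ne_top hsum s
    rw [HasFiniteIntegral]
    simp_rw [enorm_norm]
    exact ENNReal.lt_top_of_mul_ne_top_right h1
      (ENNReal.ofReal_pos.mpr (pow_pos M.β_pos _)).ne'
  refine ⟨hi, (ENNReal.summable_toReal hsum).congr fun s => ?_⟩
  rw [ENNReal.toReal_mul, ENNReal.toReal_ofReal (pow_β_nonneg _)]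
  congr 1
  simp_rw [abs_norm]
  rw [integral_norm_eq_lintegral_enorm]
  exact ((M.measurable_W d).comp measurable_fst).aestronglyMeasurable

lemma discountedFinite_chosenW {d : Fin 2} {x : EuclideanSpace ℝ (Fin k)}
    (h : M.DiscountedFinite P (fun s' => ‖M.W d s'.1‖) x) (i : Fin (kd d)) :
    M.DiscountedFinite P (M.chosenW d i) x := by
  refine h.of_abs_le (measurable_chosenW d i) fun st => ?_
  unfold chosenW
  split_ifs
  · exact PiLp.norm_apply_le (M.W d st.1) i
  · simp

lemma discountedFinite_systematic {x : EuclideanSpace ℝ (Fin k)}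
    (h : ∀ d i, M.DiscountedFinite P (M.chosenW d i) x) :
    M.DiscountedFinite P (fun st => ∑ d : Fin 2, ∑ i, M.chosenW d i st * M.θ d i) x :=
  DiscountedFinite.sum fun d _ => DiscountedFinite.sum fun i _ => (h d i).mul_const _

/-- `φ(x)` in terms of the effect of the current action. -/
lemma phi_eq {x : EuclideanSpace ℝ (Fin k)}
    (hx : ∀ s y, M.condState (s + 1) (x, y) = M.later P s (x, y)) (d : Fin 2) (i : Fin (kd d)) :
    M.phi d i x = (-1) ^ ((d : ℕ) + 1) * M.W d x i + M.effect P (M.chosenW d i) x := by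
  simp only [phi, effect, hx, chosenW]

/-! ### Optimal choice -/

variable (M P)

/-- Per-period utility under the agent's rule. -/
def ruleUtility (st : State k) : ℝ := M.utility (M.rule.1 st) st

/-- The gain in expected discounted utility from action `1` over action `0`, before the current
shocks are added. -/
def gain (x : EuclideanSpace ℝ (Fin k)) : ℝ :=
  ((∑ i, M.W 1 x i * M.θ 1 i) - ∑ i, M.W 0 x i * M.θ 0 i) + M.effect P M.ruleUtility x

variable {M P}

lemma ruleUtility_eq : M.ruleUtility
    = fun st => (∑ d : Fin 2, ∑ i, M.chosenW d i st * M.θ d i) + M.chosenShock st :=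
  funext utility_rule

lemma payoff_actionThenAgent (hP : M.IsTransition P) {st : State k}
    (h : M.DiscountedFinite P M.ruleUtility st.1) (y : Fin 2) :
    M.payoff (M.actionThenAgent y) st = M.utility y st
      + ∑' s, M.β ^ (s + 1) * ∫ s', M.ruleUtility s' ∂(M.later P s (st.1, y)) := by
  have hs : ∀ s, M.β ^ (s + 1) * ∫ s', M.utility ((M.actionThenAgent y (s + 1)).1 s') s'
        ∂(M.stateAfter (M.actionThenAgent y) (s + 1) st)
      = M.β ^ (s + 1) * ∫ s', M.ruleUtility s' ∂(M.later P s (st.1, y)) := fun s => by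
    rw [hP.stateAfter_actionThenAgent]
    rfl
  rw [payoff, Summable.tsum_eq_zero_add]
  · simp_rw [hs]
    congr 1
    rw [stateAfter, Kernel.id_apply, integral_dirac, pow_zero, one_mul]
    rfl
  · refine (summable_nat_add_iff 1).mp ?_
    simp_rw [hs]
    exact h.summable y

lemma payoffFinite_actionThenAgent (hP : M.IsTransition P) {st : State k}
    (h : M.DiscountedFinite P M.ruleUtility st.1) (y : Fin 2) :
    M.PayoffFinite (M.actionThenAgent y) st := by
  rw [PayoffFinite, tsum_eq_zero_add' ENNReal.summable]
  refine ENNReal.add_lt_top.mpr ⟨?_, ?_⟩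
  · rw [stateAfter, Kernel.id_apply, lintegral_dirac, pow_zero, ENNReal.ofReal_one, one_mul]
    exact enorm_lt_top
  · have hs : ∀ s, ENNReal.ofReal (M.β ^ (s + 1)) *
        ∫⁻ s', ‖M.utility ((M.actionThenAgent y (s + 1)).1 s') s'‖ₑ
          ∂(M.stateAfter (M.actionThenAgent y) (s + 1) st)
        = ENNReal.ofReal (M.β ^ (s + 1) * ∫ s', |M.ruleUtility s'| ∂(M.later P s (st.1, y))) :=
      fun s => by
        rw [hP.stateAfter_actionThenAgent, ENNReal.ofReal_mul (pow_β_nonneg _)]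
        congr 1
        exact (ofReal_integral_norm_eq_lintegral_enorm ((h y).1 s)).symm
    simp_rw [hs]
    exact (h y).2.tsum_ofReal_lt_top

lemma payoff_agentPlan (hP : M.IsTransition P) (st : State k) :
    M.payoff M.agentPlan st = M.payoff (M.actionThenAgent (M.rule.1 st)) st := by
  refine tsum_congr fun t => ?_
  cases t with
  | zero =>
    simp only [stateAfter, Kernel.id_apply, integral_dirac]
    rfl
  | succ s =>
    rw [hP.stateAfter_agentPlan, hP.stateAfter_actionThenAgent]
    rfl

/-- One-shot deviations do not pay, so the agent chooses action `1` exactly if the difference of the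
shocks does not exceed the gain; ties have probability zero. -/
lemma rule_eq_one_iff (h_opt : M.Optimal) (hP : M.IsTransition P)
    (hprod : M.current = M.lawX.prod M.lawShock) (h_eta : M.FullSupportShock)
    (hfin : ∀ᵐ x ∂M.lawX, M.DiscountedFinite P M.ruleUtility x) :
    ∀ᵐ x ∂M.lawX, ∀ᵐ e ∂M.lawShock, (M.rule.1 (x, e) = 1 ↔ e 0 - e 1 ≤ M.gain P x) := by
  have h_opt' := h_opt
  rw [Optimal, hprod] at h_opt'
  filter_upwards [Measure.ae_ae_of_ae_prod h_opt', hfin] with x hx hfx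
  -- The null event may be taken in each section separately, so measurability of the gain is not
  -- needed.
  have hne : ∀ᵐ e ∂M.lawShock, e 0 - e 1 ≠ M.gain P x := by
    refine ae_of_ae_map measurable_eta.aemeasurable (p := fun a => a ≠ M.gain P x) ?_
    exact measure_eq_zero_iff_ae_notMem.mp (h_eta.1 (M.gain P x))
  filter_upwards [hx, hne] with e he hne
  have hle : ∀ y, M.payoff (M.actionThenAgent y) (x, e)
      ≤ M.payoff (M.actionThenAgent (M.rule.1 (x, e))) (x, e) := fun y => by
    rw [← payoff_agentPlan hP]
    exact he.2 _ (payoffFinite_actionThenAgent hP (st := (x, e)) hfx y)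
  simp_rw [payoff_actionThenAgent hP (st := (x, e)) hfx, utility] at hle
  rw [gain, hfx.effect_eq] at hne ⊢
  constructor
  · intro h1
    have := hle 0
    rw [h1] at this
    linarith
  · intro h1
    by_contra h2
    have h3 := hle 1
    rw [show M.rule.1 (x, e) = 0 by omega] at h3
    exact hne (le_antisymm h1 (by linarith))

lemma choiceProb_eq_cdf
    {x : EuclideanSpace ℝ (Fin k)} {a : ℝ}
    (hx : condDistrib M.rule.1 Prod.fst M.current x = M.lawShock.map fun e => M.rule.1 (x, e))
    (h : ∀ᵐ e ∂M.lawShock, (M.rule.1 (x, e) = 1 ↔ e 0 - e 1 ≤ a)) :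
    M.choiceProb x = cdf M.lawEta a := by
  have hr : Measurable fun e => M.rule.1 (x, e) := M.rule.2.comp measurable_prodMk_left
  rw [choiceProb, hx, cdf_eq_real, measureReal_def, measureReal_def,
    Measure.map_apply hr (measurableSet_singleton _), lawEta,
    Measure.map_apply measurable_eta measurableSet_Iic]
  congr 1
  refine measure_congr ?_
  filter_upwards [h] with e he
  exact propext he

lemma integrable_lawEta (hint : ∀ d : Fin 2, Integrable (fun e : Fin 2 → ℝ => e d) M.lawShock) :
    Integrable (fun a => a) M.lawEta := by
  rw [lawEta, integrable_map_measure (by fun_prop) measurable_eta.aemeasurable]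
  exact (hint 0).sub (hint 1)

/-- The mean of the shock to the chosen action, given the observed state, is the mean of `ε₀` less
the partial mean of `η` below the gain. -/
lemma integral_chosenShock
    (hint : ∀ d : Fin 2, Integrable (fun e : Fin 2 → ℝ => e d) M.lawShock)
    {x : EuclideanSpace ℝ (Fin k)} {a : ℝ}
    (h : ∀ᵐ e ∂M.lawShock, (M.rule.1 (x, e) = 1 ↔ e 0 - e 1 ≤ a)) :
    ∫ e, M.chosenShock (x, e) ∂M.lawShock
      = ∫ e, e 0 ∂M.lawShock - ∫ v in Iic a, v ∂M.lawEta := by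
  have hi := integrable_lawEta hint
  have h1 : ∫ v in Iic a, v ∂M.lawEta
      = ∫ e, (Iic a).indicator (fun v => v) (e 0 - e 1) ∂M.lawShock := by
    have hm : Measurable ((Iic a).indicator fun v : ℝ => v) :=
      measurable_id.indicator measurableSet_Iic
    rw [← integral_indicator measurableSet_Iic, lawEta,
      integral_map measurable_eta.aemeasurable hm.aestronglyMeasurable]
  have h2 : Integrable (fun e : Fin 2 → ℝ => (Iic a).indicator (fun v => v) (e 0 - e 1))
      M.lawShock := by
    have := hi.indicator (measurableSet_Iic (a := a))
    rw [lawEta] at this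
    exact this.comp_measurable measurable_eta
  rw [h1, ← integral_sub (hint 0) h2]
  refine integral_congr_ae ?_
  filter_upwards [h] with e he
  rw [chosenShock_eq]
  by_cases hr : M.rule.1 (x, e) = 1
  · have := he.mp hr
    simp [hr, this]
  · have : ¬ e 0 - e 1 ≤ a := fun hc => hr (he.mpr hc)
    simp [hr, this]

/-- The mean of the shock to the chosen action is, up to a constant, minus the primitive of the
quantile function of `η` at the choice probability; so is its effect. -/
lemma effect_chosenShock (hP : M.IsTransition P) (h_eta : M.FullSupportShock)
    (hint : ∀ d : Fin 2, Integrable (fun e : Fin 2 → ℝ => e d) M.lawShock)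
    {lo hi : ℝ} (h0 : 0 ≤ lo) (h1 : hi ≤ 1) {x : EuclideanSpace ℝ (Fin k)}
    (hx : ∀ s y, ∀ᵐ st ∂(M.later P s (x, y)), M.choiceProb st.1 ∈ Icc lo hi ∧ ∃ a,
      M.choiceProb st.1 = cdf M.lawEta a ∧
        ∀ᵐ e ∂M.lawShock, (M.rule.1 (st.1, e) = 1 ↔ e 0 - e 1 ≤ a)) :
    M.effect P M.chosenShock x
      = - M.effect P
        (fun st => truncPrimitive lo hi (quantile M.lawEta) (M.choiceProb st.1)) x := by
  have := h_eta.2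
  have hη := integrable_lawEta hint
  set c := ∫ e, e 0 ∂M.lawShock - ∫ τ in (0 : ℝ)..lo, quantile M.lawEta τ with hc
  set G : State k → ℝ := fun st => truncPrimitive lo hi (quantile M.lawEta) (M.choiceProb st.1)
  have hQ : IntegrableOn (quantile M.lawEta) (Icc lo hi) := by
    refine IntegrableOn.mono_set ?_ (Icc_subset_Icc h0 h1)
    rw [integrableOn_Icc_iff_integrableOn_Ioc]
    exact integrableOn_quantile h_eta.1 hη
  have hG : M.DiscountedFinite P G x :=
    DiscountedFinite.of_bounded ((measurable_truncPrimitive hQ).comp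
      (M.measurable_choiceProb.comp measurable_fst)) fun st => abs_truncPrimitive_le hQ _
  have h2 : M.effect P M.chosenShock x = M.effect P (fun st => c + G st * (-1)) x := by
    refine effect_congr fun s y => ?_
    rw [integral_later hP ((discountedFinite_chosenShock hP hint x y).1 s)]
    refine integral_congr_ae ?_
    filter_upwards [hx s y] with st hst
    obtain ⟨hmem, a, ha, hrule⟩ := hst
    rw [integral_chosenShock hint hrule]
    simp only [G, ha]
    rw [truncPrimitive_quantile h_eta.1 hη h0 h1 (ha ▸ hmem), hc]
    ring
  rw [h2, (DiscountedFinite.of_bounded (f := fun _ => c) (C := |c|) measurable_const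
    fun _ => le_rfl).effect_add (hG.mul_const _), effect_const, effect_mul_const]
  ring

/-- The gain is the index built from `φ` and the primitive of the quantile function of `η`. -/
lemma gain_eq (hP : M.IsTransition P) {x : EuclideanSpace ℝ (Fin k)}
    (hint : ∀ d : Fin 2, Integrable (fun e : Fin 2 → ℝ => e d) M.lawShock)
    (hfin : ∀ d i, M.DiscountedFinite P (M.chosenW d i) x)
    (hx : ∀ s y, M.condState (s + 1) (x, y) = M.later P s (x, y)) :
    M.gain P x = (∑ d : Fin 2, ∑ i, M.phi d i x * M.θ d i) + M.effect P M.chosenShock x := by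
  have h1 : M.effect P M.ruleUtility x
      = (∑ d : Fin 2, ∑ i, M.effect P (M.chosenW d i) x * M.θ d i)
        + M.effect P M.chosenShock x := by
    rw [ruleUtility_eq, (discountedFinite_systematic hfin).effect_add
      (discountedFinite_chosenShock hP hint x)]
    congr 1
    rw [effect_sum fun d _ => DiscountedFinite.sum fun i _ => (hfin d i).mul_const _]
    refine Finset.sum_congr rfl fun d _ => ?_
    rw [effect_sum fun i _ => (hfin d i).mul_const _]
    exact Finset.sum_congr rfl fun i _ => effect_mul_const _ _ _
  rw [gain, h1]
  simp_rw [phi_eq hx, add_mul, Finset.sum_add_distrib, Fin.sum_univ_two]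
  simp
  ring

/-! ### Conditioning on the choice probability -/

variable (M P)

/-- Law of the choice probability. -/
def lawProb : Measure ℝ := M.lawX.map M.choiceProb

instance : IsProbabilityMeasure M.lawProb :=
  Measure.isProbabilityMeasure_map M.measurable_choiceProb.aemeasurable

/-- Conditional law of `X` given `p(X)`. -/
def stateGivenProb : Kernel ℝ (EuclideanSpace ℝ (Fin k)) :=
  condDistrib id M.choiceProb M.lawX

instance : IsMarkovKernel M.stateGivenProb := by
  unfold stateGivenProb; infer_instance

/-- The mixture over `X` given `p(X)` of the laws of the choice probability `s + 1` periods later,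
after a given current action. -/
def laterProb (s : ℕ) : Kernel (ℝ × Fin 2) ℝ :=
  ((M.later P s).comp ((M.stateGivenProb.comap Prod.fst measurable_fst).prod
    (Kernel.deterministic Prod.snd measurable_snd))).map fun st => M.choiceProb st.1

lemma measurable_choiceProb_fst : Measurable fun st : State k => M.choiceProb st.1 :=
  M.measurable_choiceProb.comp measurable_fst

instance (s : ℕ) : IsMarkovKernel (M.laterProb P s) := by
  unfold laterProb
  exact Kernel.IsMarkovKernel.map _ M.measurable_choiceProb_fst

variable {M P}

lemma laterProb_apply (s : ℕ) (t : ℝ) (y : Fin 2) :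
    M.laterProb P s (t, y) = (((M.stateGivenProb t).map fun x => (x, y)).bind (M.later P s)).map
      fun st => M.choiceProb st.1 := by
  rw [laterProb, Kernel.map_apply _ M.measurable_choiceProb_fst, Kernel.comp_apply,
    Kernel.prod_apply, Kernel.comap_apply, Kernel.deterministic_apply, Measure.prod_dirac]

lemma laterProb_apply' (s : ℕ) (t : ℝ) (y : Fin 2) {S : Set ℝ} (hS : MeasurableSet S) :
    M.laterProb P s (t, y) S
      = ∫⁻ x, M.later P s (x, y) ((fun st => M.choiceProb st.1) ⁻¹' S) ∂(M.stateGivenProb t) := by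
  rw [laterProb_apply, Measure.map_apply M.measurable_choiceProb_fst hS,
    Measure.bind_apply (M.measurable_choiceProb_fst hS) (Kernel.aemeasurable _),
    lintegral_map (Kernel.measurable_coe _ (M.measurable_choiceProb_fst hS)) (by fun_prop)]

lemma integral_laterProb (s : ℕ) (t : ℝ) (y : Fin 2) {G : ℝ → ℝ} {C : ℝ} (hG : Measurable G)
    (hC : ∀ p, |G p| ≤ C) :
    ∫ p, G p ∂(M.laterProb P s (t, y))
      = ∫ x, (∫ st, G (M.choiceProb st.1) ∂(M.later P s (x, y))) ∂(M.stateGivenProb t) := by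
  have hGp : Measurable fun st : State k => G (M.choiceProb st.1) :=
    hG.comp M.measurable_choiceProb_fst
  rw [laterProb, Kernel.map_apply _ M.measurable_choiceProb_fst,
    integral_map M.measurable_choiceProb_fst.aemeasurable hG.aestronglyMeasurable,
    Kernel.integral_comp (integrable_of_abs_le hGp.aestronglyMeasurable fun st => hC _),
    Kernel.prod_apply, Kernel.comap_apply, Kernel.deterministic_apply, Measure.prod_dirac,
    integral_map (by fun_prop)]
  exact (hGp.stronglyMeasurable.integral_kernel (κ := M.later P s)).aestronglyMeasurable

lemma measurable_prob_action :
    Measurable fun st : State k => (M.choiceProb st.1, M.rule.1 st) :=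
  M.measurable_choiceProb_fst.prodMk M.rule.2

/-- If a property of `(p(X), Y)` holds almost surely and both actions have positive conditional
probability, then it holds for almost every value of `p(X)` and both actions. -/
lemma BothActions.ae_forall_prob (hb : M.BothActions)
    (hprod : M.current = M.lawX.prod M.lawShock) {A : ℝ → Fin 2 → Prop}
    (h : ∀ᵐ a ∂(M.current.map fun st => (M.choiceProb st.1, M.rule.1 st)), A a.1 a.2) :
    ∀ᵐ t ∂M.lawProb, ∀ y, A t y := by
  -- A measurable null set containing the exceptional one makes the pushforward below legitimate.
  obtain ⟨N, hAN, hN, hN0⟩ := exists_measurable_superset_of_null (ae_iff.mp h)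
  have h1 : ∀ᵐ a ∂(M.current.map fun st => (M.choiceProb st.1, M.rule.1 st)), a ∉ N :=
    measure_eq_zero_iff_ae_notMem.mp hN0
  have h2 := hb.ae_forall hprod (A := fun x y => (M.choiceProb x, y) ∉ N)
    (ae_of_ae_map measurable_prob_action.aemeasurable h1)
  have hm : MeasurableSet {t : ℝ | ∀ y : Fin 2, (t, y) ∉ N} := by
    have : {t : ℝ | ∀ y : Fin 2, (t, y) ∉ N} = ⋂ y : Fin 2, (fun t => (t, y)) ⁻¹' Nᶜ := by
      ext t; simp
    rw [this]
    exact MeasurableSet.iInter fun y => measurable_prodMk_right hN.compl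
  have h3 : ∀ᵐ t ∂M.lawProb, ∀ y : Fin 2, (t, y) ∉ N :=
    (ae_map_iff M.measurable_choiceProb.aemeasurable hm).mpr h2
  filter_upwards [h3] with t ht y
  by_contra hA
  exact ht y (hAN hA)

lemma pairLaw_map_prob_action (s : ℕ) :
    (M.pairLaw s).map (fun ω => (M.choiceProb ω.1.1, M.rule.1 ω.1))
      = M.current.map fun st => (M.choiceProb st.1, M.rule.1 st) := by
  have : (fun ω : State k × State k => (M.choiceProb ω.1.1, M.rule.1 ω.1))
      = (fun st : State k => (M.choiceProb st.1, M.rule.1 st)) ∘ Prod.fst := rfl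
  rw [this, ← Measure.map_map measurable_prob_action measurable_fst, pairLaw]
  congr 1
  exact Measure.fst_compProd _ _

/-- The action and the observed state are conditionally independent given `p(X)`: integrals over
`(p(X), Y, X)` may be computed by drawing `X` anew from its law given `p(X)`. -/
lemma lintegral_current_prob (hprod : M.current = M.lawX.prod M.lawShock)
    {H : (ℝ × Fin 2) × EuclideanSpace ℝ (Fin k) → ENNReal} (hH : Measurable H) :
    ∫⁻ st, H ((M.choiceProb st.1, M.rule.1 st), st.1) ∂M.current
      = ∫⁻ st, ∫⁻ x, H ((M.choiceProb st.1, M.rule.1 st), x)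
          ∂(M.stateGivenProb (M.choiceProb st.1)) ∂M.current := by
  have hp := M.measurable_choiceProb
  have hD : Measurable fun a : ℝ × Fin 2 =>
      ∫⁻ x, H (a, x) ∂(M.stateGivenProb a.1) :=
    Measurable.lintegral_kernel_prod_right' (κ := M.stateGivenProb.comap Prod.fst measurable_fst) hH
  have h1 : Measurable fun a : EuclideanSpace ℝ (Fin k) × Fin 2 =>
      H ((M.choiceProb a.1, a.2), a.1) := by fun_prop
  have h2 : Measurable fun a : EuclideanSpace ℝ (Fin k) × Fin 2 =>
      ∫⁻ x, H ((M.choiceProb a.1, a.2), x) ∂(M.stateGivenProb (M.choiceProb a.1)) :=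
    hD.comp (g := fun a : ℝ × Fin 2 => ∫⁻ x, H (a, x) ∂(M.stateGivenProb a.1))
      (f := fun a : EuclideanSpace ℝ (Fin k) × Fin 2 => (M.choiceProb a.1, a.2)) (by fun_prop)
  rw [lintegral_current hprod h1, lintegral_current hprod h2]
  refine Finset.sum_congr rfl fun y _ => ?_
  have hF : Measurable fun a : ℝ × EuclideanSpace ℝ (Fin k) =>
      actionWeight y a.1 * H ((a.1, y), a.2) :=
    ((measurable_actionWeight y).comp measurable_fst).mul (by fun_prop)
  rw [← lintegral_condDistrib_id hp hF]
  refine lintegral_congr fun x => ?_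
  have hHx : Measurable fun x' => H ((M.choiceProb x, y), x') := hH.comp measurable_prodMk_left
  change ∫⁻ x', actionWeight y (M.choiceProb x) * H ((M.choiceProb x, y), x')
    ∂(M.stateGivenProb (M.choiceProb x)) = _
  exact lintegral_const_mul _ hHx

/-- The conditional law of a later choice probability given `(p(X), Y)` is the mixture over `X`
given `p(X)`. -/
lemma BothActions.condChoiceProb_eq (hb : M.BothActions)
    (hprod : M.current = M.lawX.prod M.lawShock) (hP : M.IsTransition P) :
    ∀ᵐ t ∂M.lawProb, ∀ s y, M.condChoiceProb (s + 1) (t, y) = M.laterProb P s (t, y) := by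
  rw [ae_all_iff]
  intro s
  refine hb.ae_forall_prob hprod
    (A := fun t y => M.condChoiceProb (s + 1) (t, y) = M.laterProb P s (t, y)) ?_
  have hp2 : Measurable fun ω : State k × State k => M.choiceProb ω.2.1 :=
    M.measurable_choiceProb_fst.comp measurable_snd
  have hg := M.measurable_prob_action
  have h := condDistrib_ae_eq_of_measure_eq_compProd (μ := M.pairLaw (s + 1))
    (fun ω : State k × State k => (M.choiceProb ω.1.1, M.rule.1 ω.1))
    (Y := fun ω => M.choiceProb ω.2.1) (κ := M.laterProb P s) hp2.aemeasurable (by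
      rw [pairLaw_map_prob_action]
      ext S hS
      have hgm : Measurable fun ω : State k × State k =>
          ((M.choiceProb ω.1.1, M.rule.1 ω.1), M.choiceProb ω.2.1) :=
        (hg.comp measurable_fst).prodMk hp2
      have hH : Measurable fun a : (ℝ × Fin 2) × EuclideanSpace ℝ (Fin k) =>
          M.later P s (a.2, a.1.2) {st | (a.1, M.choiceProb st.1) ∈ S} := by
        have hφ : Measurable fun a : (ℝ × Fin 2) × EuclideanSpace ℝ (Fin k) => (a.2, a.1.2) := by
          fun_prop
        exact Kernel.measurable_kernel_prodMk_left (κ := (M.later P s).comap _ hφ)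
          (((measurable_fst.comp measurable_fst).prodMk
            (M.measurable_choiceProb_fst.comp measurable_snd)) hS)
      rw [Measure.map_apply hgm hS, pairLaw, Measure.compProd_apply (hgm hS),
        Measure.compProd_apply hS, lintegral_map (Kernel.measurable_kernel_prodMk_left hS) hg]
      simp_rw [hP.stateAfter_agentPlan, laterProb_apply' _ _ _ (measurable_prodMk_left hS)]
      exact lintegral_current_prob hprod hH)
  rwa [pairLaw_map_prob_action] at h

lemma ae_stateGivenProb {A : EuclideanSpace ℝ (Fin k) → Prop} (h : ∀ᵐ x ∂M.lawX, A x) :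
    ∀ᵐ t ∂M.lawProb, ∀ᵐ x ∂(M.stateGivenProb t), A x := by
  refine Measure.ae_ae_of_ae_comp (κ := M.stateGivenProb) ?_
  rw [lawProb, stateGivenProb, condDistrib_comp_map M.measurable_choiceProb.aemeasurable
    aemeasurable_id, Measure.map_id]
  exact h

lemma ae_stateGivenProb_choiceProb_eq :
    ∀ᵐ t ∂M.lawProb, ∀ᵐ x ∂(M.stateGivenProb t), M.choiceProb x = t := by
  refine Measure.ae_ae_of_ae_compProd (κ := M.stateGivenProb)
    (p := fun a : ℝ × EuclideanSpace ℝ (Fin k) => M.choiceProb a.2 = a.1) ?_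
  have hm : MeasurableSet {a : ℝ × EuclideanSpace ℝ (Fin k) | M.choiceProb a.2 = a.1} :=
    measurableSet_eq_fun (M.measurable_choiceProb.comp measurable_snd) measurable_fst
  rw [lawProb, stateGivenProb, compProd_map_condDistrib aemeasurable_id,
    ae_map_iff (M.measurable_choiceProb.prodMk measurable_id).aemeasurable hm]
  exact Filter.Eventually.of_forall fun x => rfl

lemma ae_integrable_stateGivenProb {f : EuclideanSpace ℝ (Fin k) → ℝ}
    (hf : Integrable f M.lawX) : ∀ᵐ t ∂M.lawProb, Integrable f (M.stateGivenProb t) := by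
  have h : Integrable (fun a : ℝ × EuclideanSpace ℝ (Fin k) => f a.2)
      (M.lawProb.compProd M.stateGivenProb) := by
    rw [lawProb, stateGivenProb, compProd_map_condDistrib aemeasurable_id]
    exact hf.comp_snd_map_prodMk M.choiceProb
  exact h.ae_of_compProd

/-- `z(t)` is the mean of `φ` under the law of `X` given `p(X) = t`. -/
lemma z_eq {d : Fin 2} {i : Fin (kd d)} (hφ : Integrable (M.phi d i) M.lawX) :
    ∀ᵐ t ∂M.lawProb, M.z d i t = ∫ x, M.phi d i x ∂(M.stateGivenProb t) := by
  have hm := hφ.1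
  have hmk := hm.stronglyMeasurable_mk.measurable
  have h1 := condDistrib_comp (mβ := inferInstance) (μ := M.lawX) M.choiceProb
    (aemeasurable_id (α := EuclideanSpace ℝ (Fin k))) hmk
  filter_upwards [h1, ae_stateGivenProb hm.ae_eq_mk] with t ht hae
  rw [z, condDistrib_congr_left (X := M.choiceProb) hm.ae_eq_mk]
  have h2 : hm.mk _ ∘ id = hm.mk (M.phi d i) := rfl
  rw [h2] at ht
  rw [ht, Kernel.map_apply _ hmk, integral_map hmk.aemeasurable measurable_id'.aestronglyMeasurable]
  exact (integral_congr_ae hae).symm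

/-- Averaging the effect of the current action on a function of the later choice probability
over `X` given `p(X)`. -/
lemma integral_effect_stateGivenProb {G : ℝ → ℝ} {C : ℝ} (hG : Measurable G)
    (hC : ∀ p, |G p| ≤ C) (t : ℝ) :
    ∫ x, M.effect P (fun st => G (M.choiceProb st.1)) x ∂(M.stateGivenProb t)
      = ∑' s : ℕ, M.β ^ (s + 1) * ((∫ p, G p ∂(M.laterProb P s (t, 1)))
          - ∫ p, G p ∂(M.laterProb P s (t, 0))) := by
  have hGp : Measurable fun st : State k => G (M.choiceProb st.1) :=
    hG.comp M.measurable_choiceProb_fst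
  have hm : ∀ s y, Measurable fun x => ∫ st, G (M.choiceProb st.1) ∂(M.later P s (x, y)) :=
    fun s y => (hGp.stronglyMeasurable.integral_kernel (κ := M.later P s)).measurable.comp
      measurable_prodMk_right
  have hb : ∀ s y x, |∫ st, G (M.choiceProb st.1) ∂(M.later P s (x, y))| ≤ C := fun s y x =>
    (abs_integral_le_of_abs_le fun st => hC _).trans_eq (by simp)
  have hi : ∀ s y, Integrable (fun x => ∫ st, G (M.choiceProb st.1) ∂(M.later P s (x, y)))
      (M.stateGivenProb t) := fun s y =>
    integrable_of_abs_le (hm s y).aestronglyMeasurable (hb s y)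
  have hbd : ∀ s x, |M.β ^ (s + 1) * ((∫ st, G (M.choiceProb st.1) ∂(M.later P s (x, 1)))
      - ∫ st, G (M.choiceProb st.1) ∂(M.later P s (x, 0)))| ≤ M.β ^ (s + 1) * (2 * C) := by
    intro s x
    rw [abs_mul, abs_of_nonneg (pow_β_nonneg _)]
    refine mul_le_mul_of_nonneg_left ?_ (pow_β_nonneg _)
    exact (abs_sub _ _).trans (by linarith [hb s 0 x, hb s 1 x])
  simp only [effect]
  rw [← integral_tsum_of_summable_integral_norm]
  · refine tsum_congr fun s => ?_
    rw [integral_const_mul, integral_sub (hi s 1) (hi s 0), integral_laterProb s t 1 hG hC,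
      integral_laterProb s t 0 hG hC]
  · exact fun s => ((hi s 1).sub (hi s 0)).const_mul _
  · refine Summable.of_nonneg_of_le (fun s => integral_nonneg fun _ => norm_nonneg _) (fun s => ?_)
      ((summable_pow_β (M := M)).mul_right (2 * C))
    refine (le_abs_self _).trans ((abs_integral_le_of_abs_le fun x => ?_).trans_eq
      (by rw [probReal_univ, mul_one]))
    rw [abs_norm]
    exact hbd s x

/-! ### The integral equation as a Fredholm equation -/

lemma abs_cdf_sub_cdf_le (μ ν : Measure ℝ) (τ : ℝ) : |cdf μ τ - cdf ν τ| ≤ 1 := by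
  rw [abs_le]
  constructor <;> linarith [cdf_nonneg μ τ, cdf_nonneg ν τ, cdf_le_one μ τ, cdf_le_one ν τ]

lemma abs_kernelPi_term_le (s : ℕ) (τ t : ℝ) :
    |M.β ^ s * (cdf (M.condChoiceProb (s + 1) (t, 1)) τ
      - cdf (M.condChoiceProb (s + 1) (t, 0)) τ)| ≤ M.β ^ s := by
  rw [abs_mul, abs_of_nonneg (pow_β_nonneg _)]
  exact mul_le_of_le_one_right (pow_β_nonneg _) (abs_cdf_sub_cdf_le _ _ _)

lemma summable_kernelPi (τ t : ℝ) : Summable fun s => M.β ^ s *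
    (cdf (M.condChoiceProb (s + 1) (t, 1)) τ - cdf (M.condChoiceProb (s + 1) (t, 0)) τ) :=
  Summable.of_norm_bounded (summable_geometric_of_lt_one M.β_pos.le M.β_lt_one)
    fun s => abs_kernelPi_term_le s τ t

lemma abs_kernelPi_le (τ t : ℝ) : |M.kernelPi τ t| ≤ ∑' s : ℕ, M.β ^ s := by
  rw [← Real.norm_eq_abs]
  exact tsum_of_norm_bounded (summable_geometric_of_lt_one M.β_pos.le M.β_lt_one).hasSum
    fun s => abs_kernelPi_term_le s τ t

instance (s : ℕ) : IsMarkovKernel (M.condChoiceProb s) := by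
  unfold condChoiceProb; infer_instance

lemma measurable_cdf_condChoiceProb (s : ℕ) (y : Fin 2) :
    Measurable fun a : ℝ × ℝ => cdf (M.condChoiceProb s (a.1, y)) a.2 := by
  have hφ : Measurable fun a : ℝ × ℝ => (a.1, y) := by fun_prop
  have hS : MeasurableSet {a : (ℝ × ℝ) × ℝ | a.2 ≤ a.1.2} :=
    measurableSet_le measurable_snd (measurable_snd.comp measurable_fst)
  have h := Kernel.measurable_kernel_prodMk_left (κ := (M.condChoiceProb s).comap _ hφ) hS
  simp_rw [cdf_eq_real]
  exact h.ennreal_toReal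

lemma measurable_kernelPi : Measurable fun a : ℝ × ℝ => M.kernelPi a.2 a.1 := by
  have h : ∀ s : ℕ, Measurable fun a : ℝ × ℝ => M.β ^ s *
      (cdf (M.condChoiceProb (s + 1) (a.1, 1)) a.2
        - cdf (M.condChoiceProb (s + 1) (a.1, 0)) a.2) := fun s => by
    have h1 := measurable_cdf_condChoiceProb (M := M) (s + 1) 1
    have h0 := measurable_cdf_condChoiceProb (M := M) (s + 1) 0
    exact (h1.sub h0).const_mul (M.β ^ s)
  exact measurable_of_tendsto_metrizable
    (fun n => Finset.measurable_fun_sum (Finset.range n) fun s _ => h s)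
    (tendsto_pi_nhds.mpr fun a => (summable_kernelPi a.2 a.1).hasSum.tendsto_sum_nat)

variable (M) in
/-- The kernel `β Π(τ, t; β)` of the Fredholm equation. -/
def fredholmKernel (t τ : ℝ) : ℝ := M.β * M.kernelPi τ t

variable (M) in
lemma measurable_fredholmKernel : Measurable (Function.uncurry M.fredholmKernel) :=
  measurable_kernelPi.const_mul M.β

variable (M) in
lemma abs_fredholmKernel_le (t τ : ℝ) : |M.fredholmKernel t τ| ≤ M.β * ∑' s : ℕ, M.β ^ s := by
  rw [fredholmKernel, abs_mul, abs_of_pos M.β_pos]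
  exact mul_le_mul_of_nonneg_left (abs_kernelPi_le τ t) M.β_pos.le

lemma integral_sq_fredholmKernel_lt_one {lo hi : ℝ} (h : M.Contraction lo hi) :
    ∫ t in Icc lo hi, ∫ τ in Icc lo hi, M.fredholmKernel t τ ^ 2 < 1 := by
  simp_rw [fredholmKernel, mul_pow, integral_const_mul]
  exact h

/-- Integration by parts turns the difference of the conditional means of the primitive of `b` into
an integral of `b` against the kernel `Π`. -/
lemma tsum_truncPrimitive_eq {lo hi : ℝ} {b : ℝ → ℝ} (hb : IntegrableOn b (Icc lo hi)) (t : ℝ) :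
    ∑' s : ℕ, M.β ^ (s + 1) *
        ((∫ p, truncPrimitive lo hi b p ∂(M.condChoiceProb (s + 1) (t, 1)))
          - ∫ p, truncPrimitive lo hi b p ∂(M.condChoiceProb (s + 1) (t, 0)))
      = - ∫ τ in Icc lo hi, M.fredholmKernel t τ * b τ := by
  set F : ℕ → ℝ → ℝ := fun s τ => M.β * (M.β ^ s *
    (cdf (M.condChoiceProb (s + 1) (t, 1)) τ - cdf (M.condChoiceProb (s + 1) (t, 0)) τ)) * b τ
    with hF
  have hcdf : ∀ s y, Measurable fun τ => cdf (M.condChoiceProb (s + 1) (t, y)) τ := fun s y =>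
    (measurable_cdf_condChoiceProb (s + 1) y).comp measurable_prodMk_left
  have hFb : ∀ s τ, |F s τ| ≤ M.β ^ (s + 1) * |b τ| := fun s τ => by
    simp only [hF]
    rw [abs_mul, abs_mul, abs_of_pos M.β_pos, pow_succ']
    exact mul_le_mul_of_nonneg_right (mul_le_mul_of_nonneg_left (abs_kernelPi_term_le s τ t)
      M.β_pos.le) (abs_nonneg _)
  have hFi : ∀ s, IntegrableOn (F s) (Icc lo hi) := fun s => by
    refine (hb.abs.const_mul (M.β ^ (s + 1))).mono' ?_ (Filter.Eventually.of_forall (hFb s))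
    have hm : Measurable fun τ => M.β * (M.β ^ s * (cdf (M.condChoiceProb (s + 1) (t, 1)) τ
        - cdf (M.condChoiceProb (s + 1) (t, 0)) τ)) :=
      (((hcdf s 1).sub (hcdf s 0)).const_mul _).const_mul _
    exact hm.aestronglyMeasurable.mul hb.1
  have hterm : ∀ s, M.β ^ (s + 1) *
        ((∫ p, truncPrimitive lo hi b p ∂(M.condChoiceProb (s + 1) (t, 1)))
          - ∫ p, truncPrimitive lo hi b p ∂(M.condChoiceProb (s + 1) (t, 0)))
      = - ∫ τ in Icc lo hi, F s τ := fun s => by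
    have hi' : ∀ y, IntegrableOn
        (fun τ => b τ * (1 - cdf (M.condChoiceProb (s + 1) (t, y)) τ)) (Icc lo hi) := fun y => by
      refine hb.mul_bdd (c := 1) (measurable_const.sub (hcdf s y)).aestronglyMeasurable
        (Filter.Eventually.of_forall fun τ => ?_)
      rw [Real.norm_eq_abs, abs_le]
      constructor <;> linarith [cdf_nonneg (M.condChoiceProb (s + 1) (t, y)) τ,
        cdf_le_one (M.condChoiceProb (s + 1) (t, y)) τ]
    rw [integral_truncPrimitive hb, integral_truncPrimitive hb, ← integral_sub (hi' 1) (hi' 0),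
      ← integral_const_mul, ← integral_neg]
    refine integral_congr_ae (Filter.Eventually.of_forall fun τ => ?_)
    simp only [hF]
    ring
  simp_rw [hterm]
  rw [tsum_neg, integral_tsum_of_summable_integral_norm hFi]
  · congr 1
    refine integral_congr_ae (Filter.Eventually.of_forall fun τ => ?_)
    simp only [hF, fredholmKernel, kernelPi]
    rw [tsum_mul_right, tsum_mul_left]
  · refine Summable.of_nonneg_of_le (fun s => integral_nonneg fun _ => norm_nonneg _) (fun s => ?_)
      ((summable_pow_β (M := M)).mul_right (∫ τ in Icc lo hi, |b τ|))
    rw [← integral_const_mul]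
    exact integral_mono (hFi s).norm (hb.abs.const_mul _) (hFb s)

/-- On `[lo, hi]` the later choice probabilities stay in `[lo, hi]`, so that the integral equation
is a Fredholm equation of the second kind with kernel `β Π`. -/
lemma isBasisSolution_iff {lo hi : ℝ}
    (hC : ∀ᵐ t ∂(volume.restrict (Icc lo hi)), ∀ s y,
      ∀ᵐ p ∂(M.condChoiceProb (s + 1) (t, y)), p ∈ Icc lo hi)
    (d : Fin 2) (i : Fin (kd d)) (b : ℝ → ℝ) :
    M.IsBasisSolution lo hi d i b ↔ IntegrableOn b (Icc lo hi) ∧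
      ∀ᵐ t ∂(volume.restrict (Icc lo hi)),
        b t - ∫ τ in Icc lo hi, M.fredholmKernel t τ * b τ = M.z d i t := by
  refine and_congr_right fun hb => Filter.eventually_congr ?_
  filter_upwards [hC] with t ht
  have h : ∀ s y, ∫ p, (∫ τ in lo..p, b τ) ∂(M.condChoiceProb (s + 1) (t, y))
      = ∫ p, truncPrimitive lo hi b p ∂(M.condChoiceProb (s + 1) (t, y)) := fun s y => by
    refine integral_congr_ae ?_
    filter_upwards [ht s y] with p hp
    exact intervalIntegral_eq_truncPrimitive hp
  simp_rw [h]
  rw [tsum_truncPrimitive_eq hb, ← sub_eq_add_neg]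

/-! ### Identification of the index -/

lemma lt_of_continuousChoiceProb {lo hi : ℝ} (h : M.ContinuousChoiceProb lo hi) : lo < hi := by
  by_contra hle
  -- Otherwise `[lo, hi]` is null and the law of `p(X)` would vanish.
  have h1 : volume.restrict (Icc lo hi) = 0 := by
    rw [Measure.restrict_eq_zero, Real.volume_Icc]
    exact ENNReal.ofReal_eq_zero.mpr (by linarith)
  have h2 := h.1
  rw [h1] at h2
  have h3 : M.lawProb univ = 0 := h2 rfl
  simp at h3

/-- The support of the choice probability lies in the unit interval. -/
lemma bounds_of_continuousChoiceProb {lo hi : ℝ} (h : M.ContinuousChoiceProb lo hi) :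
    0 ≤ lo ∧ hi ≤ 1 := by
  have hlt := lt_of_continuousChoiceProb h
  have h1 : M.lawProb (Icc 0 1)ᶜ = 0 := by
    rw [lawProb, Measure.map_apply M.measurable_choiceProb measurableSet_Icc.compl]
    convert measure_empty (μ := M.lawX)
    ext x
    simpa using choiceProb_mem_Icc x
  have h2 : volume.restrict (Icc lo hi) (Icc 0 1)ᶜ = 0 := h.2 h1
  rw [Measure.restrict_apply measurableSet_Icc.compl] at h2
  have key : ∀ a b, Ioo a b ⊆ (Icc 0 1)ᶜ ∩ Icc lo hi → b ≤ a := fun a b hab => by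
    have h3 := measure_mono_null hab h2
    rw [Real.volume_Ioo, ENNReal.ofReal_eq_zero] at h3
    linarith
  constructor
  · by_contra hneg
    have := key lo (min hi 0) fun t ht => by
      have h4 := lt_min_iff.mp ht.2
      exact ⟨fun h5 => absurd h5.1 (not_le.mpr h4.2), ht.1.le, h4.1.le⟩
    rcases min_le_iff.mp this with h5 | h5 <;> linarith
  · by_contra hneg
    have := key (max lo 1) hi fun t ht => by
      have h4 := max_lt_iff.mp ht.1
      exact ⟨fun h5 => absurd h5.2 (not_le.mpr h4.2), h4.1.le, ht.2.le⟩
    rcases le_max_iff.mp this with h5 | h5 <;> linarith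

lemma ae_choiceProb_mem {lo hi : ℝ} (h : M.ContinuousChoiceProb lo hi) :
    ∀ᵐ x ∂M.lawX, M.choiceProb x ∈ Icc lo hi :=
  ae_of_ae_map M.measurable_choiceProb.aemeasurable
    (h.1.ae_le (ae_restrict_mem measurableSet_Icc))

/-- The later choice probabilities stay in the support of the current one. -/
lemma BothActions.ae_condChoiceProb_mem (hb : M.BothActions)
    (hprod : M.current = M.lawX.prod M.lawShock) (h_supp : M.StaysInSupport) {lo hi : ℝ}
    (h : M.ContinuousChoiceProb lo hi) :
    ∀ᵐ t ∂M.lawProb, ∀ s y, ∀ᵐ p ∂(M.condChoiceProb (s + 1) (t, y)), p ∈ Icc lo hi := by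
  rw [ae_all_iff]
  intro s
  refine hb.ae_forall_prob hprod
    (A := fun t y => ∀ᵐ p ∂(M.condChoiceProb (s + 1) (t, y)), p ∈ Icc lo hi) ?_
  have hp2 : Measurable fun ω : State k × State k => M.choiceProb ω.2.1 :=
    M.measurable_choiceProb_fst.comp measurable_snd
  have h1 : Measurable fun ω : State k × State k => (M.choiceProb ω.1.1, M.rule.1 ω.1) :=
    measurable_prob_action.comp measurable_fst
  rw [← pairLaw_map_prob_action (s + 1)]
  refine Measure.ae_ae_of_ae_compProd (κ := M.condChoiceProb (s + 1))
    (p := fun a : (ℝ × Fin 2) × ℝ => a.2 ∈ Icc lo hi) ?_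
  rw [condChoiceProb, compProd_map_condDistrib hp2.aemeasurable,
    ae_map_iff (h1.prodMk hp2).aemeasurable (measurable_snd measurableSet_Icc), pairLaw]
  refine Measure.ae_compProd_of_ae_ae (hp2 measurableSet_Icc) ?_
  exact ae_stateAfter h_supp (ae_current_of_ae_lawX (ae_choiceProb_mem h)) (s + 1)

/-- Finiteness of all discounted sums of the model, in almost every observed state. -/
lemma ae_discountedFinite_chosenW (hP : M.IsTransition P)
    (hprod : M.current = M.lawX.prod M.lawShock) (h_reg : M.Regular) :
    ∀ᵐ x ∂M.lawX, ∀ d i, M.DiscountedFinite P (M.chosenW d i) x := by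
  rw [ae_all_iff]
  intro d
  have h : ∀ᵐ x ∂M.lawX, M.DiscountedFinite P (fun s' => ‖M.W d s'.1‖) x := by
    refine ae_lawX_of_ae_current hprod ?_
    filter_upwards [ae_all_iff.mpr (h_reg.2.1 d)] with st hst
    exact discountedFinite_norm_W hP hst
  filter_upwards [h] with x hx i
  exact discountedFinite_chosenW hx i

lemma ae_discountedFinite_ruleUtility (hP : M.IsTransition P)
    (hprod : M.current = M.lawX.prod M.lawShock) (h_reg : M.Regular) :
    ∀ᵐ x ∂M.lawX, M.DiscountedFinite P M.ruleUtility x := by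
  filter_upwards [ae_discountedFinite_chosenW hP hprod h_reg] with x hx
  rw [ruleUtility_eq]
  exact (discountedFinite_systematic hx).add (discountedFinite_chosenShock hP h_reg.1 x)

/-- The choice probability is the distribution function of `η` at the gain. -/
lemma ae_choiceProb_eq_cdf_gain (h_opt : M.Optimal) (hP : M.IsTransition P)
    (hprod : M.current = M.lawX.prod M.lawShock) (h_reg : M.Regular)
    (h_eta : M.FullSupportShock) :
    ∀ᵐ x ∂M.lawX, M.choiceProb x = cdf M.lawEta (M.gain P x) ∧
      ∀ᵐ e ∂M.lawShock, (M.rule.1 (x, e) = 1 ↔ e 0 - e 1 ≤ M.gain P x) := by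
  filter_upwards [rule_eq_one_iff h_opt hP hprod h_eta
    (ae_discountedFinite_ruleUtility hP hprod h_reg), condDistrib_rule hprod] with x hx hx'
  exact ⟨choiceProb_eq_cdf hx' hx, hx⟩

lemma bothActions (h_opt : M.Optimal) (hP : M.IsTransition P)
    (hprod : M.current = M.lawX.prod M.lawShock) (h_reg : M.Regular)
    (h_eta : M.FullSupportShock) : M.BothActions := by
  have := h_eta.2
  refine bothActions_of_choiceProb hprod ?_
  filter_upwards [ae_choiceProb_eq_cdf_gain h_opt hP hprod h_reg h_eta] with x hx
  rw [hx.1]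
  exact cdf_mem_Ioo _

lemma integrableOn_quantile_lawEta (h_reg : M.Regular) (h_eta : M.FullSupportShock) {lo hi : ℝ}
    (h0 : 0 ≤ lo) (h1 : hi ≤ 1) : IntegrableOn (quantile M.lawEta) (Icc lo hi) := by
  have := h_eta.2
  refine IntegrableOn.mono_set ?_ (Icc_subset_Icc h0 h1)
  rw [integrableOn_Icc_iff_integrableOn_Ioc]
  exact integrableOn_quantile h_eta.1 (integrable_lawEta h_reg.1)

/-- The gain solves a fixed-point equation in the observed state in which the law of the shocks
enters only through the quantile function of `η`. -/
lemma ae_gain_eq (h_opt : M.Optimal) (hP : M.IsTransition P)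
    (hprod : M.current = M.lawX.prod M.lawShock) (h_supp : M.StaysInSupport)
    (h_reg : M.Regular) (h_eta : M.FullSupportShock) {lo hi : ℝ}
    (h_cont : M.ContinuousChoiceProb lo hi) :
    ∀ᵐ x ∂M.lawX, M.gain P x = (∑ d : Fin 2, ∑ i, M.phi d i x * M.θ d i)
      - M.effect P (fun st => truncPrimitive lo hi (quantile M.lawEta) (M.choiceProb st.1)) x := by
  have hb := bothActions h_opt hP hprod h_reg h_eta
  obtain ⟨h0, h1⟩ := bounds_of_continuousChoiceProb h_cont
  have hA : ∀ᵐ st ∂M.current, M.choiceProb st.1 ∈ Icc lo hi ∧ ∃ a,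
      M.choiceProb st.1 = cdf M.lawEta a ∧
        ∀ᵐ e ∂M.lawShock, (M.rule.1 (st.1, e) = 1 ↔ e 0 - e 1 ≤ a) := by
    refine ae_current_of_ae_lawX (A := fun x => M.choiceProb x ∈ Icc lo hi ∧ ∃ a,
      M.choiceProb x = cdf M.lawEta a ∧
        ∀ᵐ e ∂M.lawShock, (M.rule.1 (x, e) = 1 ↔ e 0 - e 1 ≤ a)) ?_
    filter_upwards [ae_choiceProb_mem h_cont,
      ae_choiceProb_eq_cdf_gain h_opt hP hprod h_reg h_eta] with x hx hx'
    exact ⟨hx, _, hx'⟩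
  filter_upwards [hb.ae_later hprod h_supp hP hA, hb.condState_eq hprod hP,
    ae_discountedFinite_chosenW hP hprod h_reg] with x hx hc hfin
  rw [gain_eq hP h_reg.1 hfin hc, effect_chosenShock hP h_eta h_reg.1 h0 h1 hx, sub_eq_add_neg]

/-- The quantile function of `η` solves the Fredholm equation whose right-hand side is
`z(t)ᵀ θ`. -/
lemma ae_quantile_fredholm (h_opt : M.Optimal) (hP : M.IsTransition P)
    (hprod : M.current = M.lawX.prod M.lawShock) (h_supp : M.StaysInSupport)
    (h_reg : M.Regular) (h_eta : M.FullSupportShock) {lo hi : ℝ}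
    (h_cont : M.ContinuousChoiceProb lo hi) :
    ∀ᵐ t ∂(volume.restrict (Icc lo hi)), quantile M.lawEta t
        - ∫ τ in Icc lo hi, M.fredholmKernel t τ * quantile M.lawEta τ
      = ∑ d : Fin 2, ∑ i, M.z d i t * M.θ d i := by
  have := h_eta.2
  have hb := bothActions h_opt hP hprod h_reg h_eta
  obtain ⟨h0, h1⟩ := bounds_of_continuousChoiceProb h_cont
  have hQ := integrableOn_quantile_lawEta h_reg h_eta h0 h1
  set G := truncPrimitive lo hi (quantile M.lawEta) with hG
  have hGm : Measurable G := measurable_truncPrimitive hQ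
  have hGb := abs_truncPrimitive_le hQ
  have hx : ∀ᵐ x ∂M.lawX, quantile M.lawEta (M.choiceProb x)
      = (∑ d : Fin 2, ∑ i, M.phi d i x * M.θ d i)
        - M.effect P (fun st => G (M.choiceProb st.1)) x := by
    filter_upwards [ae_gain_eq h_opt hP hprod h_supp h_reg h_eta h_cont,
      ae_choiceProb_eq_cdf_gain h_opt hP hprod h_reg h_eta] with x hx hx'
    rw [hx'.1, quantile_cdf, hx]
  have hz : ∀ᵐ t ∂M.lawProb, ∀ d i, M.z d i t = ∫ x, M.phi d i x ∂(M.stateGivenProb t) :=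
    ae_all_iff.mpr fun d => ae_all_iff.mpr fun i => z_eq (h_reg.2.2 d i)
  have hφ : ∀ᵐ t ∂M.lawProb, ∀ d i, Integrable (M.phi d i) (M.stateGivenProb t) :=
    ae_all_iff.mpr fun d => ae_all_iff.mpr fun i => ae_integrable_stateGivenProb (h_reg.2.2 d i)
  refine h_cont.2.ae_le (?_ : ∀ᵐ t ∂M.lawProb, _)
  filter_upwards [ae_stateGivenProb hx, ae_stateGivenProb_choiceProb_eq, hz, hφ,
    hb.condChoiceProb_eq hprod hP] with t hxt hpt hzt hφt hct
  have he : Integrable (M.effect P fun st => G (M.choiceProb st.1)) (M.stateGivenProb t) :=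
    integrable_of_abs_le (measurable_effect (hGm.comp M.measurable_choiceProb_fst)
      fun st => hGb _).aestronglyMeasurable (abs_effect_le fun st => hGb _)
  have h2 : quantile M.lawEta t = ∫ x, ((∑ d : Fin 2, ∑ i, M.phi d i x * M.θ d i)
      - M.effect P (fun st => G (M.choiceProb st.1)) x) ∂(M.stateGivenProb t) := by
    have h3 : ∫ _, quantile M.lawEta t ∂(M.stateGivenProb t) = quantile M.lawEta t := by simp
    rw [← h3]
    refine integral_congr_ae ?_
    filter_upwards [hxt, hpt] with x h4 h5
    rw [← h4, h5]
  have hφs : ∀ d ∈ Finset.univ (α := Fin 2), Integrable (fun x => ∑ i, M.phi d i x * M.θ d i)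
      (M.stateGivenProb t) := fun d _ =>
    integrable_finsetSum _ fun i _ => (hφt d i).mul_const _
  rw [integral_sub (integrable_finsetSum _ hφs) he, integral_finsetSum _ hφs,
    integral_effect_stateGivenProb hGm hGb] at h2
  simp_rw [← hct, hG] at h2
  rw [tsum_truncPrimitive_eq hQ] at h2
  have h4 : ∀ d : Fin 2, ∫ x, ∑ i, M.phi d i x * M.θ d i ∂(M.stateGivenProb t)
      = ∑ i, M.z d i t * M.θ d i := fun d => by
    rw [integral_finsetSum _ fun i _ => (hφt d i).mul_const _]
    refine Finset.sum_congr rfl fun i _ => ?_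
    rw [integral_mul_const, hzt d i]
  simp_rw [h4] at h2
  linarith

/-- A weighted sum of solutions is the quantile function of `η`. -/
lemma ae_sum_basis_eq_quantile (h_opt : M.Optimal) (hP : M.IsTransition P)
    (hprod : M.current = M.lawX.prod M.lawShock) (h_supp : M.StaysInSupport)
    (h_reg : M.Regular) (h_eta : M.FullSupportShock) {lo hi : ℝ}
    (h_cont : M.ContinuousChoiceProb lo hi) (h_contr : M.Contraction lo hi)
    {B : (d : Fin 2) → Fin (kd d) → ℝ → ℝ}
    (hBi : ∀ d i, IntegrableOn (B d i) (Icc lo hi))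
    (hB : ∀ d i, ∀ᵐ t ∂(volume.restrict (Icc lo hi)),
      B d i t - ∫ τ in Icc lo hi, M.fredholmKernel t τ * B d i τ = M.z d i t) :
    ∀ᵐ t ∂(volume.restrict (Icc lo hi)),
      ∑ j : (Σ d, Fin (kd d)), B j.1 j.2 t * M.θ j.1 j.2 = quantile M.lawEta t := by
  obtain ⟨h0, h1⟩ := bounds_of_continuousChoiceProb h_cont
  have hQ := integrableOn_quantile_lawEta h_reg h_eta h0 h1
  have hKm := M.measurable_fredholmKernel
  have hKb := M.abs_fredholmKernel_le
  have hS : IntegrableOn (fun t => ∑ j : (Σ d, Fin (kd d)), B j.1 j.2 t * M.θ j.1 j.2)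
      (Icc lo hi) := integrable_finsetSum _ fun j _ => (hBi j.1 j.2).mul_const _
  have hBall := ae_all_iff.mpr fun d => ae_all_iff.mpr (hB d)
  have h := ae_eq_zero_of_fredholm hKm hKb (integral_sq_fredholmKernel_lt_one h_contr)
    (c := fun t => (∑ j : (Σ d, Fin (kd d)), B j.1 j.2 t * M.θ j.1 j.2) - quantile M.lawEta t)
    (hS.sub hQ) (by
      filter_upwards [hBall, ae_quantile_fredholm h_opt hP hprod h_supp h_reg h_eta h_cont]
        with t htB htQ
      have hKS : ∫ τ in Icc lo hi, M.fredholmKernel t τ *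
            ∑ j : (Σ d, Fin (kd d)), B j.1 j.2 τ * M.θ j.1 j.2
          = ∑ j : (Σ d, Fin (kd d)),
            (∫ τ in Icc lo hi, M.fredholmKernel t τ * B j.1 j.2 τ) * M.θ j.1 j.2 := by
        simp_rw [Finset.mul_sum, ← mul_assoc]
        rw [integral_finsetSum _ fun j _ =>
          (integrable_kernel_section_mul hKm hKb (hBi j.1 j.2) t).mul_const _]
        simp_rw [integral_mul_const]
      simp_rw [mul_sub]
      rw [integral_sub (integrable_kernel_section_mul hKm hKb hS t)
        (integrable_kernel_section_mul hKm hKb hQ t), hKS]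
      have hz : ∑ d : Fin 2, ∑ i, M.z d i t * M.θ d i
          = ∑ j : (Σ d, Fin (kd d)), B j.1 j.2 t * M.θ j.1 j.2 - ∑ j : (Σ d, Fin (kd d)),
            (∫ τ in Icc lo hi, M.fredholmKernel t τ * B j.1 j.2 τ) * M.θ j.1 j.2 := by
        rw [← Finset.sum_sub_distrib, Fintype.sum_sigma]
        simp_rw [← htB, sub_mul]
      linarith)
  filter_upwards [h] with t ht
  exact sub_eq_zero.mp ht

/-- The index built from solutions of the integral equation, in terms of the effect of the current
action on the primitives. -/
lemma index_eq {lo hi : ℝ} {B : (d : Fin 2) → Fin (kd d) → ℝ → ℝ}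
    {x : EuclideanSpace ℝ (Fin k)}
    (hc : ∀ s y, M.condState (s + 1) (x, y) = M.later P s (x, y))
    (hx : ∀ s y, ∀ᵐ st ∂(M.later P s (x, y)), M.choiceProb st.1 ∈ Icc lo hi)
    (d : Fin 2) (i : Fin (kd d)) :
    M.index lo B d i x = M.phi d i x
      - M.effect P (fun st => truncPrimitive lo hi (B d i) (M.choiceProb st.1)) x := by
  have h : ∀ s y, ∫ st, (∫ τ in lo..(M.choiceProb st.1), B d i τ) ∂(M.later P s (x, y))
      = ∫ st, truncPrimitive lo hi (B d i) (M.choiceProb st.1) ∂(M.later P s (x, y)) :=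
    fun s y => by
      refine integral_congr_ae ?_
      filter_upwards [hx s y] with st hst
      exact intervalIntegral_eq_truncPrimitive hst
  simp only [index, effect, hc, h]

end Model

end DynamicChoice

end

open DynamicChoice

theorem theorem1 {k : ℕ} {kd : Fin 2 → ℕ} (M : DynamicChoice.Model k kd) (lo hi : ℝ)
    (h_opt : M.Optimal) (h_supp : M.StaysInSupport)
    (h_ind : M.ConditionalIndependence) (h_reg : M.Regular) (h_eta : M.FullSupportShock)
    (h_cont : M.ContinuousChoiceProb lo hi) (h_contr : M.Contraction lo hi) :
    (∀ (d : Fin 2) (i : Fin (kd d)),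
      ((∃ b, M.IsBasisSolution lo hi d i b) ↔ IntegrableOn (M.z d i) (Icc lo hi)) ∧
      ∀ b b', M.IsBasisSolution lo hi d i b → M.IsBasisSolution lo hi d i b' →
        ∀ᵐ t ∂(volume.restrict (Icc lo hi)), b t = b' t) ∧
    ∀ B : (d : Fin 2) → Fin (kd d) → ℝ → ℝ,
      (∀ d i, M.IsBasisSolution lo hi d i (B d i)) →
      ∀ᵐ x ∂M.lawX,
        (condDistrib M.rule.1 Prod.fst M.current x).real {1} =
          cdf M.lawEta (∑ d : Fin 2, ∑ i : Fin (kd d), M.index lo B d i x * M.θ d i) := by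
  obtain ⟨⟨P, hPm, hP⟩, hprod⟩ := h_ind
  replace hP : M.IsTransition P := hP
  have hb := Model.bothActions h_opt hP hprod h_reg h_eta
  have hKm := M.measurable_fredholmKernel
  have hKb := M.abs_fredholmKernel_le
  have hK1 := Model.integral_sq_fredholmKernel_lt_one h_contr
  have hiff := Model.isBasisSolution_iff (M := M) (lo := lo) (hi := hi)
    (h_cont.2.ae_le (hb.ae_condChoiceProb_mem hprod h_supp h_cont))
  refine ⟨fun d i => ⟨⟨?_, fun hz => ?_⟩, fun b b' h h' => ?_⟩, fun B hB => ?_⟩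
  · rintro ⟨b, hbs⟩
    obtain ⟨hbi, hbe⟩ := (hiff d i b).mp hbs
    have hKi : IntegrableOn (fun t => ∫ τ in Icc lo hi, M.fredholmKernel t τ * b τ) (Icc lo hi) :=
      integrable_of_abs_le
        (stronglyMeasurable_integral_kernel_mul hKm hbi.1).aestronglyMeasurable
        (abs_integral_kernel_mul_le hKb hbi)
    exact (hbi.sub hKi).congr hbe
  · obtain ⟨b, hbi, hbe⟩ := exists_fredholm_solution hKm hKb hK1 hz
    exact ⟨b, (hiff d i b).mpr ⟨hbi, Filter.Eventually.of_forall hbe⟩⟩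
  · obtain ⟨hbi, hbe⟩ := (hiff d i b).mp h
    obtain ⟨hbi', hbe'⟩ := (hiff d i b').mp h'
    have h0 := ae_eq_zero_of_fredholm hKm hKb hK1 (c := fun t => b t - b' t) (hbi.sub hbi') (by
      filter_upwards [hbe, hbe'] with t ht ht'
      simp_rw [mul_sub]
      rw [integral_sub (integrable_kernel_section_mul hKm hKb hbi t)
        (integrable_kernel_section_mul hKm hKb hbi' t)]
      linarith)
    filter_upwards [h0] with t ht
    exact sub_eq_zero.mp ht
  · have hBi : ∀ d i, IntegrableOn (B d i) (Icc lo hi) := fun d i => (hB d i).1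
    have hsum := Model.ae_sum_basis_eq_quantile h_opt hP hprod h_supp h_reg h_eta h_cont h_contr
      hBi fun d i => ((hiff d i _).mp (hB d i)).2
    filter_upwards [Model.ae_gain_eq h_opt hP hprod h_supp h_reg h_eta h_cont,
      Model.ae_choiceProb_eq_cdf_gain h_opt hP hprod h_reg h_eta, hb.condState_eq hprod hP,
      hb.ae_later hprod h_supp hP
        (Model.ae_current_of_ae_lawX (Model.ae_choiceProb_mem h_cont))] with x hg hp hc hx
    refine hp.1.trans (congrArg _ ?_)
    have hfin : ∀ d i, M.DiscountedFinite P
        (fun st => truncPrimitive lo hi (B d i) (M.choiceProb st.1)) x := fun d i =>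
      Model.DiscountedFinite.of_bounded ((measurable_truncPrimitive (hBi d i)).comp
        M.measurable_choiceProb_fst) fun st => abs_truncPrimitive_le (hBi d i) _
    rw [hg, ← truncPrimitive_congr hsum]
    simp_rw [truncPrimitive_sum Finset.univ (fun j : (Σ d, Fin (kd d)) => M.θ j.1 j.2)
      (fun j => B j.1 j.2) fun j _ => hBi j.1 j.2]
    rw [Model.effect_sum fun j _ => (hfin j.1 j.2).mul_const _, Fintype.sum_sigma,
      ← Finset.sum_sub_distrib]
    refine Finset.sum_congr rfl fun d _ => ?_
    rw [← Finset.sum_sub_distrib]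
    refine Finset.sum_congr rfl fun i _ => ?_
    rw [Model.index_eq hc hx, Model.effect_mul_const, sub_mul]
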